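/- Let $H$ be a complex Hilbert space, $m\ge 1$, $R_0\in B(H)$ a positive operator and $C_1,\dots,C_m\in B(H)$ contractions ($\|C_j\|\le 1$). Assume that $R_0$ is trace class. Write $S_1(H)$ for the Banach space of trace class operators with the trace norm $\|A\|_1=\operatorname{tr}|A|$, and $S_1(H)_+$ for its cone of positive operators. For finite words $w$ over $\{1,\dots,m\}$ define $R_\emptyset:=R_0$, $R_{wj}:=R_w^{1/2}(I-C_j^*C_j)R_w^{1/2}$ and $D_{w,j}:=R_w^{1/2}C_j^*C_jR_w^{1/2}=R_w-R_{wj}$. For a word $u$ over $\mathcal A:=\{0,1,\dots,m\}$ let $R_u:=R_v$, where $v$ is the longest prefix of $u$ that contains no $0$; put $D_{u,a}:=R_u^{1/2}C_a^*C_aR_u^{1/2}$ if $a\ne 0$ and $u$ contains no $0$, and $D_{u,a}:=0$ otherwise. Let $\Omega:=\mathcal A^{\mathbb N}$ with its Borel $\sigma$-algebra. Put $s_w:=\sum_{j=1}^m\operatorname{tr}(D_{w,j})$. Let $p_{u,j}:=\operatorname{tr}(D_{u,j})/s_u$ for $j\ge 1$ and $p_{u,0}:=0$ if $u$ contains no $0$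 and $s_u>0$; in all other cases let $p_{u,0}:=1$ and $p_{u,j}:=0$ for $j\ge1$. Let $\nu_{\mathrm{tr}}$ be the unique probability measure on $\Omega$ whose values on cylinder sets satisfy $\nu_{\mathrm{tr}}([\emptyset])=1$ and $\nu_{\mathrm{tr}}([ua])=\nu_{\mathrm{tr}}([u])\,p_{u,a}$. For $\omega=(\omega_1,\omega_2,\dots)\in\Omega$ put $R_n(\omega):=R_{\omega_1\cdots\omega_n}$ for $n\ge0$, $D_n(\omega):=D_{\omega_1\cdots\omega_{n-1},\omega_n}$ for $n\ge1$, $\tau(\omega):=\inf\{n\ge1:\omega_n=0\}\in\{1,2,\dots\}\cup\{\infty\}$, $R_\infty(\omega):=\operatorname{s-lim}_{n\to\infty}R_n(\omega)$, and $\Sigma(\omega):=\sum_{n=1}^{\tau(\omega)-1}D_n(\omega)$ (a sum in trace norm). All integrals of operators below are Bochner integrals in $S_1(H)$. Then, for every $\omega$, the strong limit $R_\infty(\omega)$ exists and belongs to $S_1(H)_+$, and the following hold. 1. For $\nu_{\mathrm{tr}}$-a.e. $\omega$, the series defining $\Sigma(\omega)$ converges in trace norm to an element of $S_1(H)_+$,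 and $\Sigma(\omega)=R_0-R_\infty(\omega)$ in $S_1(H)$. 2. Each $D_n$ is $\nu_{\mathrm{tr}}$-integrable. For every Borel set $E\subset\Omega$ the series $\mathsf M(E):=\sum_{n=1}^\infty\int_E D_n\,d\nu_{\mathrm{tr}}$ converges in trace norm to an element of $S_1(H)_+$, and $\mathsf M$ is countably additive in trace norm. Moreover $\mathsf M\ll\nu_{\mathrm{tr}}$, $\Sigma$ is $\nu_{\mathrm{tr}}$-integrable, and $\mathsf M(E)=\int_E\Sigma\,d\nu_{\mathrm{tr}}$ for all Borel $E\subset\Omega$. 3. $R_\infty$ and $\operatorname{tr}(R_\infty)$ are $\nu_{\mathrm{tr}}$-integrable, $\mathsf M(\Omega)=R_0-\int_\Omega R_\infty\,d\nu_{\mathrm{tr}}$, and $\operatorname{tr}(\mathsf M(\Omega))=\operatorname{tr}(R_0)-\int_\Omega\operatorname{tr}(R_\infty)\,d\nu_{\mathrm{tr}}$. 4. Suppose uniform trace leakage: there is $\alpha\in(0,m]$ such that $s_w\ge\alpha\operatorname{tr}(R_w)$ for every finite word $w$ over $\{1,\dots,m\}$. Then $\Sigma(\omega)=R_0$ for $\nu_{\mathrm{tr}}$-a.e.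 $\omega$, and $\mathsf M(E)=\nu_{\mathrm{tr}}(E)R_0$ for all Borel $E\subset\Omega$. -/

import Mathlib

open MeasureTheory ProbabilityTheory Filter Topology
open scoped ENNReal InnerProductSpace

set_option linter.unusedSectionVars false

noncomputable section

namespace WR

section TraceClassOperators

variable {H : Type*} [NormedAddCommGroup H] [InnerProductSpace ℂ H]

/-- An index set for an orthonormal basis of `H`. -/
def basisIndex (H : Type*) [NormedAddCommGroup H] [InnerProductSpace ℂ H] [CompleteSpace H] :
    Set H :=
  (exists_hilbertBasis ℂ H).choose

variable [CompleteSpace H]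

/-- A fixed orthonormal basis of `H`, used to write traces as sums of diagonal entries; traces
and trace norms do not depend on it. -/
def basis (H : Type*) [NormedAddCommGroup H] [InnerProductSpace ℂ H] [CompleteSpace H] :
    HilbertBasis (basisIndex H) ℂ H :=
  (exists_hilbertBasis ℂ H).choose_spec.choose

/-- The trace norm `‖A‖₁ = tr |A| = ∑ ⟨eᵢ, |A| eᵢ⟩`, where `|A| = (A* A)^{1/2}`, as an extended
nonnegative number. -/
def traceNormE (A : H →L[ℂ] H) : ℝ≥0∞ :=
  ∑' i, ENNReal.ofReal (⟪basis H i, CFC.abs A (basis H i)⟫_ℂ).re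

/-- `A` is trace class if `tr |A| < ∞`. -/
def IsTraceClass (A : H →L[ℂ] H) : Prop := traceNormE A < ∞

/-- The trace `∑ ⟨eᵢ, A eᵢ⟩` (meaningful for trace class `A`). -/
def opTrace (A : H →L[ℂ] H) : ℂ := ∑' i, ⟪basis H i, A (basis H i)⟫_ℂ

theorem tsum_enorm_inner_sq {ι : Type*} (b : HilbertBasis ι ℂ H) (x : H) :
    ∑' i, ‖⟪b i, x⟫_ℂ‖ₑ ^ 2 = ‖x‖ₑ ^ 2 := by
  have h := (b.hasSum_inner_mul_inner x x).mapL Complex.reCLM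
  have h2 : HasSum (fun i => ‖⟪b i, x⟫_ℂ‖ ^ 2) (‖x‖ ^ 2) := by
    convert h using 1
    · ext i
      have h3 : ⟪x, b i⟫_ℂ = (starRingEnd ℂ) ⟪b i, x⟫_ℂ := (inner_conj_symm _ _).symm
      rw [h3, ← Complex.normSq_eq_conj_mul_self, Complex.normSq_eq_norm_sq]
      simp [-Complex.ofReal_pow]
    · have := inner_self_eq_norm_sq (𝕜 := ℂ) x
      simpa using this.symm
  have h4 := ENNReal.ofReal_tsum_of_nonneg (fun i => by positivity) h2.summable
  rw [h2.tsum_eq] at h4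
  simp only [← ofReal_norm, ← ENNReal.ofReal_pow (norm_nonneg _)]
  exact h4.symm

/-- Squared Hilbert-Schmidt norm with respect to a basis. -/
def hsE {ι : Type*} (b : HilbertBasis ι ℂ H) (S : H →L[ℂ] H) : ℝ≥0∞ := ∑' i, ‖S (b i)‖ₑ ^ 2

theorem hsE_adjoint {ι κ : Type*} (b : HilbertBasis ι ℂ H) (c : HilbertBasis κ ℂ H)
    (S : H →L[ℂ] H) : hsE b S = hsE c (star S) := by
  unfold hsE
  simp_rw [← tsum_enorm_inner_sq c (S _), ← tsum_enorm_inner_sq b (star S _)]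
  rw [ENNReal.tsum_comm]
  refine tsum_congr fun j => tsum_congr fun i => ?_
  rw [ContinuousLinearMap.star_eq_adjoint, ContinuousLinearMap.adjoint_inner_right,
    ← inner_conj_symm, ← ofReal_norm, ← ofReal_norm, RCLike.norm_conj]

theorem hsE_mul_left_le {ι : Type*} (b : HilbertBasis ι ℂ H) (W S : H →L[ℂ] H) (hW : ‖W‖ ≤ 1) :
    hsE b (W * S) ≤ hsE b S := by
  refine ENNReal.tsum_le_tsum fun i => ?_
  gcongr
  rw [← ofReal_norm, ← ofReal_norm]
  apply ENNReal.ofReal_le_ofReal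
  calc ‖W (S (b i))‖ ≤ ‖W‖ * ‖S (b i)‖ := W.le_opNorm _
    _ ≤ 1 * ‖S (b i)‖ := by gcongr
    _ = _ := one_mul _

theorem hsE_mul_right_le {ι : Type*} (b : HilbertBasis ι ℂ H) (S W : H →L[ℂ] H) (hW : ‖W‖ ≤ 1) :
    hsE b (S * W) ≤ hsE b S := by
  rw [hsE_adjoint b b (S * W), hsE_adjoint b b S, star_mul]
  exact hsE_mul_left_le b _ _ (by rwa [norm_star])

/-- Diagonal entries of `S * S` for `S` positive. -/
theorem inner_sqrt (P : H →L[ℂ] H) (hP : 0 ≤ P) (x : H) :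
    ENNReal.ofReal (⟪x, P x⟫_ℂ).re = ‖CFC.sqrt P x‖ₑ ^ 2 := by
  have hS : star (CFC.sqrt P) = CFC.sqrt P := (CFC.sqrt_nonneg P).isSelfAdjoint.star_eq
  have h : ⟪x, P x⟫_ℂ = ⟪CFC.sqrt P x, CFC.sqrt P x⟫_ℂ := by
    conv_lhs => rw [← CFC.sqrt_mul_sqrt_self P hP]
    rw [mul_apply_eq_comp, ← ContinuousLinearMap.adjoint_inner_left,
      ← ContinuousLinearMap.star_eq_adjoint, hS]
  rw [h, ← ofReal_norm, ← ENNReal.ofReal_pow (norm_nonneg _)]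
  congr 1
  exact inner_self_eq_norm_sq (𝕜 := ℂ) _

theorem traceNormE_eq_hsE (A : H →L[ℂ] H) :
    traceNormE A = hsE (basis H) (CFC.sqrt (CFC.abs A)) :=
  tsum_congr fun _ => inner_sqrt _ (CFC.abs_nonneg A) _

/-- The trace norm does not depend on the orthonormal basis. -/
theorem traceNormE_eq_tsum {ι : Type*} (b : HilbertBasis ι ℂ H) (A : H →L[ℂ] H) :
    traceNormE A = ∑' i, ENNReal.ofReal (⟪b i, CFC.abs A (b i)⟫_ℂ).re := by
  have hS : star (CFC.sqrt (CFC.abs A)) = CFC.sqrt (CFC.abs A) :=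
    (CFC.sqrt_nonneg _).isSelfAdjoint.star_eq
  rw [traceNormE_eq_hsE, hsE_adjoint (basis H) b, hS]
  exact tsum_congr fun _ => (inner_sqrt _ (CFC.abs_nonneg A) _).symm

theorem norm_abs_apply (A : H →L[ℂ] H) (x : H) : ‖CFC.abs A x‖ = ‖A x‖ := by
  have hS : star (CFC.abs A) = CFC.abs A := (CFC.abs_nonneg A).isSelfAdjoint.star_eq
  have h : ⟪CFC.abs A x, CFC.abs A x⟫_ℂ = ⟪A x, A x⟫_ℂ := by
    rw [← ContinuousLinearMap.adjoint_inner_right, ← ContinuousLinearMap.star_eq_adjoint, hS,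
      ← mul_apply_eq_comp, CFC.abs_mul_abs, mul_apply_eq_comp,
      ContinuousLinearMap.star_eq_adjoint, ContinuousLinearMap.adjoint_inner_right]
  rw [inner_self_eq_norm_sq_to_K, inner_self_eq_norm_sq_to_K] at h
  have h2 : ‖CFC.abs A x‖ ^ 2 = ‖A x‖ ^ 2 := by exact_mod_cast h
  exact (pow_left_inj₀ (norm_nonneg _) (norm_nonneg _) two_ne_zero).1 h2

/-- Polar decomposition. -/
theorem exists_polar (A : H →L[ℂ] H) :
    ∃ V : H →L[ℂ] H, ‖V‖ ≤ 1 ∧ V * CFC.abs A = A ∧ star V * A = CFC.abs A := by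
  set P := CFC.abs A with hPdef
  let K : Submodule ℂ H := (LinearMap.range P.toLinearMap).topologicalClosure
  have hK : IsClosed (K : Set H) := Submodule.isClosed_topologicalClosure _
  have : CompleteSpace K := hK.completeSpace_coe
  let e : H →ₗ[ℂ] K := P.toLinearMap.codRestrict K
    (fun x => Submodule.le_topologicalClosure _ (LinearMap.mem_range_self _ x))
  have he : ∀ x, ((e x : K) : H) = P x := fun _ => rfl
  have hd : DenseRange e := by
    rw [DenseRange, dense_iff_closure_eq, Set.eq_univ_iff_forall]
    rintro ⟨y, hy⟩
    rw [closure_subtype]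
    have : ((↑) '' Set.range e : Set H) = (LinearMap.range P.toLinearMap : Set H) := by
      ext z
      simp [he]
    rw [this]
    exact hy
  have hn : ∀ x, ‖A.toLinearMap x‖ ≤ 1 * ‖e x‖ := fun x => by
    rw [one_mul]; change ‖A x‖ ≤ ‖P x‖; rw [norm_abs_apply]
  let g : K →L[ℂ] H := A.toLinearMap.extendOfNorm e
  have hg : ∀ x, g (e x) = A x := fun x => LinearMap.extendOfNorm_eq hd ⟨1, hn⟩ x
  have hgn : ‖g‖ ≤ 1 := LinearMap.opNorm_extendOfNorm_le hd zero_le_one hn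
  let Q : H →L[ℂ] K := K.orthogonalProjectionOnto
  have hQn : ‖Q‖ ≤ 1 := Submodule.orthogonalProjectionOnto_norm_le K
  have hQe : ∀ x, Q (P x) = e x := fun x =>
    Submodule.orthogonalProjectionOnto_mem_subspace_eq_self (e x)
  have hin : ∀ (x : H) (z : K), ⟪A x, g z⟫_ℂ = ⟪P x, (z : H)⟫_ℂ := by
    intro x z
    refine hd.induction_on (p := fun z => ⟪A x, g z⟫_ℂ = ⟪P x, (z : H)⟫_ℂ) z
      (isClosed_eq (by fun_prop) (by fun_prop)) fun y => ?_
    have hS : star P = P := (CFC.abs_nonneg A).isSelfAdjoint.star_eq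
    rw [hg, he, ← ContinuousLinearMap.adjoint_inner_right P, ← ContinuousLinearMap.star_eq_adjoint,
      hS, ← mul_apply_eq_comp, hPdef, CFC.abs_mul_abs, mul_apply_eq_comp,
      ContinuousLinearMap.star_eq_adjoint, ContinuousLinearMap.adjoint_inner_right]
  refine ⟨g.comp Q, ?_, ?_, ?_⟩
  · calc ‖g.comp Q‖ ≤ ‖g‖ * ‖Q‖ := g.opNorm_comp_le Q
      _ ≤ 1 * 1 := by gcongr
      _ = 1 := one_mul _
  · ext x
    change g (Q (P x)) = A x
    rw [hQe, hg]
  · ext x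
    refine ext_inner_right ℂ fun y => ?_
    rw [mul_apply_eq_comp, ContinuousLinearMap.star_eq_adjoint,
      ContinuousLinearMap.adjoint_inner_left]
    change ⟪A x, g (Q y)⟫_ℂ = _
    rw [hin]
    have : ⟪e x, Q y⟫_ℂ = ⟪(e x : H), y⟫_ℂ :=
      Submodule.inner_orthogonalProjectionOnto_eq_of_mem_left (e x) y
    exact this

/-- Every contraction `K` gives a lower bound for the trace norm. -/
theorem tsum_enorm_inner_le (A K : H →L[ℂ] H) (hK : ‖K‖ ≤ 1) :
    ∑' i, ‖⟪K (basis H i), A (basis H i)⟫_ℂ‖ₑ ≤ traceNormE A := by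
  obtain ⟨V, hV, hVA, -⟩ := exists_polar A
  set S := CFC.sqrt (CFC.abs A) with hSdef
  have hS : star S = S := (CFC.sqrt_nonneg (CFC.abs A)).isSelfAdjoint.star_eq
  have hSS : S * S = CFC.abs A := CFC.sqrt_mul_sqrt_self _ (CFC.abs_nonneg A)
  have hVK : ‖star V * K‖ ≤ 1 :=
    (norm_mul_le _ _).trans (mul_le_one₀ (by rwa [norm_star]) (norm_nonneg _) hK)
  have key : ∀ x : H, 2 * ‖⟪K x, A x⟫_ℂ‖ₑ ≤ ‖(S * (star V * K)) x‖ₑ ^ 2 + ‖S x‖ₑ ^ 2 := by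
    intro x
    have h1 : ⟪K x, A x⟫_ℂ = ⟪(S * (star V * K)) x, S x⟫_ℂ := by
      conv_lhs => rw [← hVA, ← hSS]
      simp only [mul_apply_eq_comp]
      conv_rhs => rw [← hS]
      rw [ContinuousLinearMap.star_eq_adjoint, ContinuousLinearMap.adjoint_inner_left,
        ContinuousLinearMap.star_eq_adjoint, ContinuousLinearMap.adjoint_inner_left,
        ← ContinuousLinearMap.star_eq_adjoint, hS]
    rw [h1]
    simp only [← ofReal_norm]
    rw [← ENNReal.ofReal_pow (norm_nonneg _), ← ENNReal.ofReal_pow (norm_nonneg _),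
      ← ENNReal.ofReal_add (by positivity) (by positivity),
      show (2 : ℝ≥0∞) = ENNReal.ofReal 2 by simp, ← ENNReal.ofReal_mul (by norm_num)]
    apply ENNReal.ofReal_le_ofReal
    have := norm_inner_le_norm (𝕜 := ℂ) ((S * (star V * K)) x) (S x)
    nlinarith [sq_nonneg (‖(S * (star V * K)) x‖ - ‖S x‖)]
  have h2 : 2 * ∑' i, ‖⟪K (basis H i), A (basis H i)⟫_ℂ‖ₑ ≤ 2 * traceNormE A := by
    rw [← ENNReal.tsum_mul_left]
    calc _ ≤ ∑' i, (‖(S * (star V * K)) (basis H i)‖ₑ ^ 2 + ‖S (basis H i)‖ₑ ^ 2) :=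
          ENNReal.tsum_le_tsum fun i => key _
      _ = hsE (basis H) (S * (star V * K)) + hsE (basis H) S := ENNReal.tsum_add
      _ ≤ hsE (basis H) S + hsE (basis H) S := by
          gcongr; exact hsE_mul_right_le _ _ _ hVK
      _ = 2 * traceNormE A := by rw [traceNormE_eq_hsE, two_mul]
  exact (ENNReal.mul_le_mul_iff_right (by norm_num) (by norm_num)).1 h2

/-- The trace norm is bounded by `c` as soon as all the lower bounds from contractions are. -/
theorem traceNormE_le_of_forall (A : H →L[ℂ] H) (c : ℝ≥0∞)
    (h : ∀ K : H →L[ℂ] H, ‖K‖ ≤ 1 → ∀ s : Finset (basisIndex H),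
      ∑ i ∈ s, ‖⟪K (basis H i), A (basis H i)⟫_ℂ‖ₑ ≤ c) : traceNormE A ≤ c := by
  obtain ⟨V, hV, -, hVA⟩ := exists_polar A
  rw [traceNormE, ENNReal.tsum_eq_iSup_sum]
  refine iSup_le fun s => le_trans (Finset.sum_le_sum fun i _ => ?_) (h V hV s)
  rw [← hVA, mul_apply_eq_comp, ContinuousLinearMap.star_eq_adjoint,
    ContinuousLinearMap.adjoint_inner_right, ← ofReal_norm]
  exact ENNReal.ofReal_le_ofReal (Complex.re_le_norm _)

theorem sum_enorm_inner_le (A K : H →L[ℂ] H) (hK : ‖K‖ ≤ 1) (s : Finset (basisIndex H)) :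
    ∑ i ∈ s, ‖⟪K (basis H i), A (basis H i)⟫_ℂ‖ₑ ≤ traceNormE A :=
  (ENNReal.sum_le_tsum s).trans (tsum_enorm_inner_le A K hK)

theorem traceNormE_add_le (A B : H →L[ℂ] H) :
    traceNormE (A + B) ≤ traceNormE A + traceNormE B := by
  refine traceNormE_le_of_forall _ _ fun K hK s => ?_
  calc _ ≤ ∑ i ∈ s, (‖⟪K (basis H i), A (basis H i)⟫_ℂ‖ₑ
        + ‖⟪K (basis H i), B (basis H i)⟫_ℂ‖ₑ) := by
        refine Finset.sum_le_sum fun i _ => ?_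
        rw [add_apply, inner_add_right]
        exact enorm_add_le _ _
    _ ≤ _ := by
        rw [Finset.sum_add_distrib]
        exact add_le_add (sum_enorm_inner_le A K hK s) (sum_enorm_inner_le B K hK s)

theorem traceNormE_zero : traceNormE (0 : H →L[ℂ] H) = 0 := by
  simp [traceNormE]

theorem traceNormE_smul (c : ℂ) (A : H →L[ℂ] H) : traceNormE (c • A) = ‖c‖ₑ * traceNormE A := by
  rw [traceNormE, traceNormE, ← ENNReal.tsum_mul_left]
  refine tsum_congr fun i => ?_
  rw [CFC.abs_smul, ← ofReal_norm, ← ENNReal.ofReal_mul (norm_nonneg _)]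
  congr 1
  simp

theorem enorm_le_traceNormE (A : H →L[ℂ] H) : ‖A‖ₑ ≤ traceNormE A := by
  set S := CFC.sqrt (CFC.abs A) with hSdef
  have hS : star S = S := (CFC.sqrt_nonneg (CFC.abs A)).isSelfAdjoint.star_eq
  have hSS : S * S = CFC.abs A := CFC.sqrt_mul_sqrt_self _ (CFC.abs_nonneg A)
  rcases eq_or_ne (traceNormE A) ∞ with h | h
  · rw [h]; exact le_top
  have hbound : ∀ x : H, ‖S x‖ₑ ^ 2 ≤ traceNormE A * ‖x‖ₑ ^ 2 := by
    intro x
    rw [← tsum_enorm_inner_sq (basis H) (S x), traceNormE_eq_hsE, hsE, ← ENNReal.tsum_mul_right]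
    refine ENNReal.tsum_le_tsum fun i => ?_
    rw [← mul_pow]
    gcongr
    have h1 : ⟪basis H i, S x⟫_ℂ = ⟪S (basis H i), x⟫_ℂ := by
      conv_rhs => rw [← hS, ContinuousLinearMap.star_eq_adjoint,
        ContinuousLinearMap.adjoint_inner_left]
    rw [h1]
    simp only [← ofReal_norm]
    rw [← ENNReal.ofReal_mul (norm_nonneg _)]
    exact ENNReal.ofReal_le_ofReal (norm_inner_le_norm _ _)
  have hreal : ∀ x : H, ‖S x‖ ≤ Real.sqrt (traceNormE A).toReal * ‖x‖ := by
    intro x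
    have h2 := ENNReal.toReal_mono (ENNReal.mul_ne_top h (by simp)) (hbound x)
    simp only [ENNReal.toReal_mul, ENNReal.toReal_pow, toReal_enorm] at h2
    have h3 := Real.sqrt_le_sqrt h2
    rwa [Real.sqrt_mul ENNReal.toReal_nonneg, Real.sqrt_sq (norm_nonneg _),
      Real.sqrt_sq (norm_nonneg _)] at h3
  have hSn : ‖S‖ ≤ Real.sqrt (traceNormE A).toReal :=
    S.opNorm_le_bound (Real.sqrt_nonneg _) hreal
  have hA : ‖A‖ ≤ (traceNormE A).toReal := by
    rw [← CFC.norm_abs, ← hSS]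
    calc ‖S * S‖ ≤ ‖S‖ * ‖S‖ := norm_mul_le _ _
      _ ≤ Real.sqrt (traceNormE A).toReal * Real.sqrt (traceNormE A).toReal := by gcongr
      _ = _ := Real.mul_self_sqrt ENNReal.toReal_nonneg
  rw [← ofReal_norm]
  exact ENNReal.ofReal_le_of_le_toReal hA

/-- The trace class operators as a linear subspace of `B(H)`. -/
def traceClassSubmodule (H : Type*) [NormedAddCommGroup H] [InnerProductSpace ℂ H]
    [CompleteSpace H] : Submodule ℂ (H →L[ℂ] H) where
  carrier := {A | IsTraceClass A}
  zero_mem' := by simp [IsTraceClass, traceNormE_zero]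
  add_mem' {A B} hA hB := (traceNormE_add_le A B).trans_lt (ENNReal.add_lt_top.2 ⟨hA, hB⟩)
  smul_mem' c A hA := by
    change traceNormE (c • A) < ∞
    rw [traceNormE_smul]
    exact ENNReal.mul_lt_top enorm_lt_top hA

/-- The space `S₁(H)` of trace class operators; it carries the trace norm, not the operator
norm. -/
def TraceClass (H : Type*) [NormedAddCommGroup H] [InnerProductSpace ℂ H] [CompleteSpace H] :
    Type _ :=
  ↥(traceClassSubmodule H)

namespace TraceClass

instance : AddCommGroup (TraceClass H) := inferInstanceAs (AddCommGroup ↥(traceClassSubmodule H))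

instance : Module ℂ (TraceClass H) := inferInstanceAs (Module ℂ ↥(traceClassSubmodule H))

/-- The underlying bounded operator. -/
def toOp : TraceClass H →ₗ[ℂ] (H →L[ℂ] H) := (traceClassSubmodule H).subtype

theorem toOp_injective : Function.Injective (toOp : TraceClass H →ₗ[ℂ] (H →L[ℂ] H)) :=
  Subtype.val_injective

theorem isTraceClass (A : TraceClass H) : IsTraceClass (toOp A) := A.2

/-- A trace class operator as an element of `S₁(H)`. -/
def mk (A : H →L[ℂ] H) (hA : IsTraceClass A) : TraceClass H := ⟨A, hA⟩

open Classical in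
/-- A bounded operator as an element of `S₁(H)`, with value `0` if it is not trace class. -/
def ofOp (A : H →L[ℂ] H) : TraceClass H := if h : IsTraceClass A then mk A h else 0

@[simp] theorem toOp_mk (A : H →L[ℂ] H) (hA : IsTraceClass A) : toOp (mk A hA) = A := rfl

/-- The trace norm `‖A‖₁ = tr |A|`. -/
instance : Norm (TraceClass H) := ⟨fun A => (traceNormE (toOp A)).toReal⟩

theorem norm_def (A : TraceClass H) : ‖A‖ = (traceNormE (toOp A)).toReal := rfl

theorem ofReal_norm_eq (A : TraceClass H) : ENNReal.ofReal ‖A‖ = traceNormE (toOp A) :=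
  ENNReal.ofReal_toReal (isTraceClass A).ne

theorem norm_toOp_le (A : TraceClass H) : ‖toOp A‖ ≤ ‖A‖ := by
  have h := enorm_le_traceNormE (toOp A)
  rw [← ofReal_norm, ← ofReal_norm_eq] at h
  exact (ENNReal.ofReal_le_ofReal_iff ENNReal.toReal_nonneg).1 h

theorem normedSpaceCore : NormedSpace.Core ℂ (TraceClass H) where
  norm_nonneg A := ENNReal.toReal_nonneg
  norm_smul c A := by
    rw [norm_def, norm_def, map_smul, traceNormE_smul, ENNReal.toReal_mul, toReal_enorm]
  norm_triangle A B := by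
    rw [norm_def, norm_def, norm_def, map_add,
      ← ENNReal.toReal_add (isTraceClass A).ne (isTraceClass B).ne]
    exact ENNReal.toReal_mono (ENNReal.add_lt_top.2 ⟨isTraceClass A, isTraceClass B⟩).ne
      (traceNormE_add_le _ _)
  norm_eq_zero_iff A := by
    constructor
    · intro h
      have := norm_toOp_le A
      rw [h] at this
      exact toOp_injective (by rw [map_zero]; exact norm_le_zero_iff.1 this)
    · rintro rfl
      rw [norm_def, map_zero, traceNormE_zero, ENNReal.toReal_zero]

instance : NormedAddCommGroup (TraceClass H) := NormedAddCommGroup.ofCore normedSpaceCore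

instance : NormedSpace ℂ (TraceClass H) := NormedSpace.ofCore normedSpaceCore

/-- `S₁(H)` is a Banach space. -/
instance : CompleteSpace (TraceClass H) := by
  refine Metric.complete_of_cauchySeq_tendsto fun u hu => ?_
  have hop : CauchySeq fun n => toOp (u n) := by
    rw [Metric.cauchySeq_iff] at hu ⊢
    intro ε hε
    obtain ⟨N, hN⟩ := hu ε hε
    refine ⟨N, fun m hm n hn => lt_of_le_of_lt ?_ (hN m hm n hn)⟩
    rw [dist_eq_norm, dist_eq_norm, ← map_sub]
    exact norm_toOp_le _
  obtain ⟨A, hA⟩ := cauchySeq_tendsto_of_complete hop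
  have hlim : ∀ x : H, Tendsto (fun n => toOp (u n) x) atTop (𝓝 (A x)) := fun x =>
    ((ContinuousLinearMap.apply ℂ H x).continuous.tendsto A).comp hA
  have key : ∀ ε > 0, ∃ N, ∀ n ≥ N, traceNormE (toOp (u n) - A) ≤ ENNReal.ofReal ε := by
    intro ε hε
    obtain ⟨N, hN⟩ := Metric.cauchySeq_iff.1 hu ε hε
    refine ⟨N, fun n hn => traceNormE_le_of_forall _ _ fun K hK s => ?_⟩
    have ht : Tendsto (fun m => ∑ i ∈ s, ‖⟪K (basis H i), (toOp (u n) - toOp (u m)) (basis H i)⟫_ℂ‖ₑ)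
        atTop (𝓝 (∑ i ∈ s, ‖⟪K (basis H i), (toOp (u n) - A) (basis H i)⟫_ℂ‖ₑ)) := by
      refine tendsto_finsetSum _ fun i _ => ?_
      refine (continuous_enorm.tendsto _).comp ?_
      refine Tendsto.inner tendsto_const_nhds ?_
      exact tendsto_const_nhds.sub (hlim _)
    refine le_of_tendsto ht (eventually_atTop.2 ⟨N, fun m hm => ?_⟩)
    refine (sum_enorm_inner_le _ K hK s).trans ?_
    rw [← map_sub, ← ofReal_norm_eq, ← dist_eq_norm]
    exact ENNReal.ofReal_le_ofReal (hN n hn m hm).le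
  have hAtc : IsTraceClass A := by
    obtain ⟨N, hN⟩ := key 1 one_pos
    have h1 : IsTraceClass (toOp (u N) - A) := (hN N le_rfl).trans_lt ENNReal.ofReal_lt_top
    have h2 := (traceClassSubmodule H).sub_mem (isTraceClass (u N)) h1
    rwa [sub_sub_cancel] at h2
  refine ⟨mk A hAtc, Metric.tendsto_atTop.2 fun ε hε => ?_⟩
  obtain ⟨N, hN⟩ := key (ε / 2) (half_pos hε)
  refine ⟨N, fun n hn => ?_⟩
  have h := hN n hn
  have h' : ENNReal.ofReal ‖u n - mk A hAtc‖ ≤ ENNReal.ofReal (ε / 2) := by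
    rw [ofReal_norm_eq, map_sub, toOp_mk]; exact h
  rw [dist_eq_norm]
  exact lt_of_le_of_lt ((ENNReal.ofReal_le_ofReal_iff (half_pos hε).le).1 h') (half_lt_self hε)

end TraceClass

/-- A positive operator dominated by a trace class operator is trace class. -/
theorem IsTraceClass.of_le {A B : H →L[ℂ] H} (hA : 0 ≤ A) (hAB : A ≤ B) (hB : IsTraceClass B) :
    IsTraceClass A := by
  refine lt_of_le_of_lt (ENNReal.tsum_le_tsum fun i => ENNReal.ofReal_le_ofReal ?_) hB
  rw [CFC.abs_of_nonneg A hA, CFC.abs_of_nonneg B (hA.trans hAB)]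
  have := ((ContinuousLinearMap.le_def A B).1 hAB).re_inner_nonneg_right (basis H i)
  simpa [inner_sub_right] using this

theorem opTrace_re_nonneg {A : H →L[ℂ] H} (hA : 0 ≤ A) : 0 ≤ (opTrace A).re := by
  have hA' := (ContinuousLinearMap.nonneg_iff_isPositive A).1 hA
  by_cases h : Summable fun i => ⟪basis H i, A (basis H i)⟫_ℂ
  · have h2 := h.hasSum.mapL Complex.reCLM
    exact h2.nonneg fun i => hA'.re_inner_nonneg_right _
  · rw [opTrace, tsum_eq_zero_of_not_summable h, Complex.zero_re]

theorem hasSum_inner_of_hs {ι κ : Type*} (b : HilbertBasis ι ℂ H) (c : HilbertBasis κ ℂ H)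
    (X Y : H →L[ℂ] H) (hX : hsE c X < ∞) (hY : hsE c Y < ∞) :
    ∃ t, HasSum (fun i => ⟪X (c i), Y (c i)⟫_ℂ) t ∧
      HasSum (fun j => ⟪star Y (b j), star X (b j)⟫_ℂ) t := by
  have hsq : ∀ Z : H →L[ℂ] H, hsE c Z < ∞ →
      Summable fun p : κ × ι => ‖⟪b p.2, Z (c p.1)⟫_ℂ‖ ^ 2 := by
    intro Z hZ
    have h1 : ∑' p : κ × ι, ‖⟪b p.2, Z (c p.1)⟫_ℂ‖ₑ ^ 2 = hsE c Z := by
      rw [ENNReal.tsum_prod', hsE]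
      refine tsum_congr fun i => ?_
      exact tsum_enorm_inner_sq b (Z (c i))
    have h3 : ∑' p : κ × ι, ‖⟪b p.2, Z (c p.1)⟫_ℂ‖ₑ ^ 2 ≠ ∞ := by
      rw [h1]; exact hZ.ne
    have h2 := ENNReal.summable_toReal h3
    simpa only [ENNReal.toReal_pow, toReal_enorm] using h2
  have hs : Summable fun p : κ × ι => ⟪X (c p.1), b p.2⟫_ℂ * ⟪b p.2, Y (c p.1)⟫_ℂ := by
    refine Summable.of_norm_bounded ((hsq X hX).add (hsq Y hY)) fun p => ?_
    have h1 : ‖⟪X (c p.1), b p.2⟫_ℂ‖ = ‖⟪b p.2, X (c p.1)⟫_ℂ‖ := norm_inner_symm _ _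
    rw [norm_mul, h1]
    generalize ‖⟪b p.2, X (c p.1)⟫_ℂ‖ = r
    generalize ‖⟪b p.2, Y (c p.1)⟫_ℂ‖ = s
    nlinarith [sq_nonneg (r - s), sq_nonneg r, sq_nonneg s]
  obtain ⟨t, ht⟩ := hs
  have h1 : HasSum (fun i => ⟪X (c i), Y (c i)⟫_ℂ) t :=
    HasSum.prod_fiberwise ht fun i => b.hasSum_inner_mul_inner (X (c i)) (Y (c i))
  have ht' : HasSum (fun p : ι × κ => ⟪X (c p.2), b p.1⟫_ℂ * ⟪b p.1, Y (c p.2)⟫_ℂ) t :=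
    (Equiv.prodComm ι κ).hasSum_iff.2 ht
  refine ⟨t, h1, HasSum.prod_fiberwise ht' fun j => ?_⟩
  have h2 := c.hasSum_inner_mul_inner (star Y (b j)) (star X (b j))
  have h3 : ∀ i, ⟪star Y (b j), c i⟫_ℂ * ⟪c i, star X (b j)⟫_ℂ
      = ⟪X (c i), b j⟫_ℂ * ⟪b j, Y (c i)⟫_ℂ := fun i => by
    rw [ContinuousLinearMap.star_eq_adjoint, ContinuousLinearMap.star_eq_adjoint,
      ContinuousLinearMap.adjoint_inner_left, ContinuousLinearMap.adjoint_inner_right, mul_comm]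
  simpa only [h3] using h2

/-- The trace of a trace class operator is a convergent sum which can be computed in every
orthonormal basis. -/
theorem hasSum_opTrace {ι : Type*} (c : HilbertBasis ι ℂ H) (A : H →L[ℂ] H)
    (hA : IsTraceClass A) : HasSum (fun i => ⟪c i, A (c i)⟫_ℂ) (opTrace A) := by
  obtain ⟨V, hV, hVA, -⟩ := exists_polar A
  set S := CFC.sqrt (CFC.abs A) with hSdef
  have hS : star S = S := (CFC.sqrt_nonneg (CFC.abs A)).isSelfAdjoint.star_eq
  have hSS : S * S = CFC.abs A := CFC.sqrt_mul_sqrt_self _ (CFC.abs_nonneg A)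
  have hfin : hsE (basis H) S < ∞ := by
    rw [← traceNormE_eq_hsE]; exact hA
  have hfinc : hsE c S < ∞ := by
    rw [hsE_adjoint c (basis H), hS]; exact hfin
  have hV' : ‖star V‖ ≤ 1 := by rwa [norm_star]
  have h1 : ∀ x : H, ⟪x, A x⟫_ℂ = ⟪(S * star V) x, S x⟫_ℂ := by
    intro x
    conv_lhs => rw [← hVA, ← hSS]
    simp only [mul_apply_eq_comp]
    conv_rhs => rw [← hS]
    rw [ContinuousLinearMap.star_eq_adjoint, ContinuousLinearMap.adjoint_inner_left,
      ContinuousLinearMap.star_eq_adjoint, ContinuousLinearMap.adjoint_inner_left,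
      ← ContinuousLinearMap.star_eq_adjoint, hS]
  obtain ⟨t, ht, ht'⟩ := hasSum_inner_of_hs (basis H) c (S * star V) S
    ((hsE_mul_right_le c S _ hV').trans_lt hfinc) hfinc
  obtain ⟨t2, ht2, ht2'⟩ :=
    hasSum_inner_of_hs (basis H) (basis H) (S * star V) S
      ((hsE_mul_right_le _ S _ hV').trans_lt hfin) hfin
  have htt : t = t2 := ht'.unique ht2'
  simp only [h1, opTrace]
  rw [ht2.tsum_eq, ← htt]
  exact ht

end TraceClassOperators

section EnergyTree

/-- The data of a contraction energy tree: a positive operator `R₀` and contractions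
`C₁, …, C_m` on `H`. -/
structure ContractionTree (m : ℕ) (H : Type*) [NormedAddCommGroup H] [InnerProductSpace ℂ H]
    [CompleteSpace H] where
  /-- the initial operator -/
  R0 : H →L[ℂ] H
  R0_nonneg : 0 ≤ R0
  /-- the contractions -/
  C : Fin m → H →L[ℂ] H
  norm_C_le : ∀ j, ‖C j‖ ≤ 1

/-- The path space `Ω = {0, 1, …, m}^ℕ`, with the product topology and its Borel σ-algebra (which
is the product σ-algebra). The letter `ω_{n+1}` of the path `ω = (ω₁, ω₂, …)` is `ω n`; the symbol
`0` is termination and the symbol `j ∈ {1, …, m}` is `Fin.succ` of the corresponding index. -/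
abbrev PathSpace (m : ℕ) : Type := ℕ → Fin (m + 1)

/-- The prefix `ω|n = ω₁ ⋯ ω_n`. -/
def pathPrefix {m : ℕ} (ω : PathSpace m) (n : ℕ) : List (Fin (m + 1)) :=
  List.ofFn fun i : Fin n => ω i

/-- The cylinder set `[u]` of a finite word. -/
def cylinderSet {m : ℕ} (u : List (Fin (m + 1))) : Set (PathSpace m) :=
  {ω | pathPrefix ω u.length = u}

/-- The maximal prefix of a word which contains no `0`, as a word over `{1, …, m}`. -/
def stem {m : ℕ} : List (Fin (m + 1)) → List (Fin m)
  | [] => []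
  | a :: u => Fin.cases [] (fun j => j :: stem u) a

/-- The termination time `τ(ω) = inf {n ≥ 1 : ω_n = 0}`, with `inf ∅ = ∞`. -/
def terminationTime {m : ℕ} (ω : PathSpace m) : ℕ∞ :=
  sInf {t : ℕ∞ | ∃ n : ℕ, ω n = 0 ∧ t = (n : ℕ∞) + 1}

namespace ContractionTree

variable {H : Type*} [NormedAddCommGroup H] [InnerProductSpace ℂ H] [CompleteSpace H] {m : ℕ}
  (T : ContractionTree m H)

/-- The residual update `Φ_j(R) = R^{1/2} (I - C_j* C_j) R^{1/2}`. -/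
def update (j : Fin m) (R : H →L[ℂ] H) : H →L[ℂ] H :=
  CFC.sqrt R * (1 - star (T.C j) * T.C j) * CFC.sqrt R

/-- The residual `R_w` at a word over `{1, …, m}`: `R_∅ = R₀` and `R_{wj} = Φ_j(R_w)`. -/
def nodeResidual (w : List (Fin m)) : H →L[ℂ] H :=
  w.foldl (fun R j => T.update j R) T.R0

/-- The dissipated piece `D_{w,j} = R_w^{1/2} C_j* C_j R_w^{1/2}` of the edge `w → wj`. -/
def nodeDissipation (w : List (Fin m)) (j : Fin m) : H →L[ℂ] H :=
  CFC.sqrt (T.nodeResidual w) * (star (T.C j) * T.C j) * CFC.sqrt (T.nodeResidual w)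

/-- The residual `R_u` of a word over `{0, …, m}`, frozen at the first `0`. -/
def residual (u : List (Fin (m + 1))) : H →L[ℂ] H := T.nodeResidual (stem u)

/-- The dissipated piece `D_{u,a}` for a word over `{0, …, m}` and a letter `a`; it vanishes if
`a = 0` or if `u` contains a `0`. -/
def dissipation (u : List (Fin (m + 1))) (a : Fin (m + 1)) : H →L[ℂ] H :=
  if 0 ∈ u then 0 else Fin.cases 0 (fun j => T.nodeDissipation (stem u) j) a

/-- The residual process `R_n(ω) = R_{ω|n}`. -/
def residualAt (n : ℕ) (ω : PathSpace m) : H →L[ℂ] H := T.residual (pathPrefix ω n)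

/-- The dissipation process, with the index shifted by one: `T.dissipationAt n ω` is
`D_{n+1}(ω) = D_{ω|n, ω_{n+1}}`. -/
def dissipationAt (n : ℕ) (ω : PathSpace m) : H →L[ℂ] H :=
  T.dissipation (pathPrefix ω n) (ω n)

open Classical in
/-- The tail residual `R_∞(ω) = s-lim R_n(ω)` (and `0` if the strong limit does not exist). -/
def tailResidual (ω : PathSpace m) : H →L[ℂ] H :=
  if h : ∃ A : H →L[ℂ] H, ∀ x, Tendsto (fun n => T.residualAt n ω x) atTop (𝓝 (A x)) then h.choose
  else 0

/-! Positivity of residuals and dissipated pieces, and the one-step splitting. -/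

theorem star_mul_self_C_le (j : Fin m) : star (T.C j) * T.C j ≤ 1 :=
  CStarAlgebra.star_mul_le_algebraMap_norm_sq.trans (by
    have h : ‖T.C j‖ ^ 2 ≤ 1 := pow_le_one₀ (norm_nonneg _) (T.norm_C_le j)
    simpa using algebraMap_mono (H →L[ℂ] H) h)

theorem update_nonneg (j : Fin m) (R : H →L[ℂ] H) : 0 ≤ T.update j R :=
  (CFC.sqrt_nonneg R).isSelfAdjoint.conjugate_nonneg (sub_nonneg.2 (T.star_mul_self_C_le j))

theorem nodeResidual_append (w : List (Fin m)) (j : Fin m) :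
    T.nodeResidual (w ++ [j]) = T.update j (T.nodeResidual w) := by
  simp [nodeResidual]

theorem nodeResidual_nonneg (w : List (Fin m)) : 0 ≤ T.nodeResidual w := by
  induction w using List.reverseRecOn with
  | nil => exact T.R0_nonneg
  | append_singleton w j ih => rw [nodeResidual_append]; exact T.update_nonneg j _

theorem nodeDissipation_nonneg (w : List (Fin m)) (j : Fin m) : 0 ≤ T.nodeDissipation w j :=
  (CFC.sqrt_nonneg _).isSelfAdjoint.conjugate_nonneg (star_mul_self_nonneg _)

/-- `D_{w,j} = R_w - R_{wj}`. -/
theorem nodeDissipation_eq_sub (w : List (Fin m)) (j : Fin m) :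
    T.nodeDissipation w j = T.nodeResidual w - T.nodeResidual (w ++ [j]) := by
  rw [nodeResidual_append, update, nodeDissipation, mul_sub, sub_mul, mul_one,
    CFC.sqrt_mul_sqrt_self _ (T.nodeResidual_nonneg w), sub_sub_cancel]

theorem nodeResidual_le (w : List (Fin m)) : T.nodeResidual w ≤ T.R0 := by
  induction w using List.reverseRecOn with
  | nil => exact le_rfl
  | append_singleton w j ih =>
    have := T.nodeDissipation_nonneg w j
    rw [nodeDissipation_eq_sub, sub_nonneg] at this
    exact this.trans ih

theorem nodeDissipation_le (w : List (Fin m)) (j : Fin m) : T.nodeDissipation w j ≤ T.R0 := by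
  rw [nodeDissipation_eq_sub]
  exact (sub_le_self _ (T.nodeResidual_nonneg _)).trans (T.nodeResidual_le w)

theorem dissipation_mem (u : List (Fin (m + 1))) (a : Fin (m + 1)) :
    0 ≤ T.dissipation u a ∧ T.dissipation u a ≤ T.R0 := by
  unfold dissipation
  split_ifs
  · exact ⟨le_rfl, T.R0_nonneg⟩
  · refine Fin.cases ?_ (fun j => ?_) a
    · exact ⟨le_rfl, T.R0_nonneg⟩
    · exact ⟨T.nodeDissipation_nonneg _ j, T.nodeDissipation_le _ j⟩

/-! The trace-biased path measure. -/

/-- The trace edge energy `tr D_{w,j}`. -/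
def edgeEnergy (w : List (Fin m)) (j : Fin m) : ℝ := (opTrace (T.nodeDissipation w j)).re

/-- The total trace edge energy `s_w = ∑_j tr D_{w,j}`. -/
def nodeEnergy (w : List (Fin m)) : ℝ := ∑ j, T.edgeEnergy w j

/-- The trace-biased transition probabilities `p_{u,a}`: with `w = u` the current node,
`p_{w,j} = tr D_{w,j} / s_w` and `p_{w,0} = 0` if `s_w > 0`; the symbol `0` has probability one if
`s_w = 0` or if `u` already contains a `0`. -/
def transProb (u : List (Fin (m + 1))) (a : Fin (m + 1)) : ℝ :=
  if 0 ∈ u ∨ T.nodeEnergy (stem u) = 0 then (if a = 0 then 1 else 0)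
  else Fin.cases 0 (fun j => T.edgeEnergy (stem u) j / T.nodeEnergy (stem u)) a

theorem edgeEnergy_nonneg (w : List (Fin m)) (j : Fin m) : 0 ≤ T.edgeEnergy w j :=
  opTrace_re_nonneg (T.nodeDissipation_nonneg w j)

theorem nodeEnergy_nonneg (w : List (Fin m)) : 0 ≤ T.nodeEnergy w :=
  Finset.sum_nonneg fun j _ => T.edgeEnergy_nonneg w j

theorem transProb_nonneg (u : List (Fin (m + 1))) (a : Fin (m + 1)) : 0 ≤ T.transProb u a := by
  unfold transProb
  split_ifs
  · exact zero_le_one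
  · exact le_rfl
  · refine Fin.cases le_rfl (fun j => ?_) a
    exact div_nonneg (T.edgeEnergy_nonneg _ j) (T.nodeEnergy_nonneg _)

theorem sum_transProb (u : List (Fin (m + 1))) : ∑ a, T.transProb u a = 1 := by
  unfold transProb
  split_ifs with h
  · simp
  · rw [Fin.sum_univ_succ]
    simp only [Fin.cases_zero, Fin.cases_succ, zero_add, ← Finset.sum_div]
    exact div_self fun h0 => h (Or.inr h0)

/-- The law of the next letter after the prefix `u`. -/
def stepMeasure (u : List (Fin (m + 1))) : Measure (Fin (m + 1)) :=
  ∑ a, ENNReal.ofReal (T.transProb u a) • Measure.dirac a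

theorem stepMeasure_singleton (u : List (Fin (m + 1))) (a : Fin (m + 1)) :
    T.stepMeasure u {a} = ENNReal.ofReal (T.transProb u a) := by
  simp [stepMeasure, Set.indicator_apply]

instance (u : List (Fin (m + 1))) : IsProbabilityMeasure (T.stepMeasure u) := ⟨by
  simp only [stepMeasure, Measure.coe_finsetSum, Finset.sum_apply, Measure.smul_apply,
    measure_univ, smul_eq_mul, mul_one]
  rw [← ENNReal.ofReal_sum_of_nonneg fun a _ => T.transProb_nonneg u a, sum_transProb,
    ENNReal.ofReal_one]⟩

/-- The transition kernel from the first `n + 1` letters to the next one. -/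
def stepKernel (n : ℕ) : Kernel (Finset.Iic n → Fin (m + 1)) (Fin (m + 1)) :=
  Kernel.ofFunOfCountable fun x =>
    T.stepMeasure (List.ofFn fun i : Fin (n + 1) =>
      x ⟨i, Finset.mem_Iic.2 (Nat.lt_succ_iff.1 i.2)⟩)

instance (n : ℕ) : IsMarkovKernel (T.stepKernel n) :=
  ⟨fun _ => by
    change IsProbabilityMeasure (T.stepMeasure _)
    infer_instance⟩

/-- The trace-biased path measure `ν_tr` on `Ω`: the probability measure whose cylinder
probabilities are `ν_tr[∅] = 1` and `ν_tr[ua] = ν_tr[u] p_{u,a}`. -/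
def traceMeasure : Measure (PathSpace m) :=
  Kernel.trajMeasure (X := fun _ => Fin (m + 1)) (T.stepMeasure []) T.stepKernel

instance : IsProbabilityMeasure T.traceMeasure := by
  unfold traceMeasure
  infer_instance

theorem cylinderSet_nil : cylinderSet ([] : List (Fin (m + 1))) = Set.univ := by
  simp [cylinderSet, pathPrefix]

theorem traceMeasure_cylinderSet_nil : T.traceMeasure (cylinderSet []) = 1 := by
  rw [cylinderSet_nil, measure_univ]

theorem traceMeasure_map_zero :
    T.traceMeasure.map (fun ω : PathSpace m => ω 0) = T.stepMeasure [] := by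
  have h : (fun ω : PathSpace m => ω 0) =
      (fun x : Finset.Iic 0 → Fin (m + 1) => x ⟨0, by simp⟩) ∘
        (Preorder.frestrictLe (π := fun _ => Fin (m + 1)) 0) := rfl
  rw [h, ← Measure.map_map (by fun_prop) (by fun_prop), traceMeasure, Kernel.trajMeasure,
    Measure.map_comp _ _ (by fun_prop), Kernel.traj_map_frestrictLe, Kernel.partialTraj_self,
    Measure.id_comp, Measure.map_map (by fun_prop) (by fun_prop)]
  exact Measure.map_id

theorem traceMeasure_cylinderSet_append (u : List (Fin (m + 1))) (a : Fin (m + 1)) :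
    T.traceMeasure (cylinderSet (u ++ [a])) =
      T.traceMeasure (cylinderSet u) * ENNReal.ofReal (T.transProb u a) := by
  rcases List.eq_nil_or_concat' u with rfl | ⟨v, b, rfl⟩
  · rw [traceMeasure_cylinderSet_nil, one_mul, ← stepMeasure_singleton,
      ← traceMeasure_map_zero, Measure.map_apply (by fun_prop) (measurableSet_singleton a)]
    congr 1
    ext ω
    simp [cylinderSet, pathPrefix]
  · set u := v ++ [b] with hu
    have hlen : u.length = v.length + 1 := by simp [hu]
    generalize v.length = n at hlen
    clear_value u
    let s : Finset.Iic n → Fin (m + 1) := fun i =>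
      u[(i : ℕ)]'(by have := Finset.mem_Iic.1 i.2; omega)
    have hs : (List.ofFn fun i : Fin (n + 1) =>
        s ⟨i, Finset.mem_Iic.2 (Nat.lt_succ_iff.1 i.2)⟩) = u := by
      apply List.ext_getElem
      · simp [hlen]
      · intro i h1 h2
        rw [List.getElem_ofFn]
    have h1 : cylinderSet u = (Preorder.frestrictLe n : PathSpace m → _) ⁻¹' {s} := by
      ext ω
      simp only [cylinderSet, Set.mem_ofPred_eq, Set.mem_preimage, Set.mem_singleton_iff]
      constructor
      · intro h
        funext i
        have hi := Finset.mem_Iic.1 i.2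
        have h2 : u[(i : ℕ)]'(by omega) = (pathPrefix ω u.length)[(i : ℕ)]'(by
          simp [pathPrefix]; omega) := by
          congr 1
          exact h.symm
        change ω i = u[(i : ℕ)]'_
        rw [h2]
        simp [pathPrefix]
      · intro h
        apply List.ext_getElem
        · simp [pathPrefix]
        · intro i h2 h3
          have h4 := congrFun h ⟨i, Finset.mem_Iic.2 (by omega)⟩
          change ω i = u[i]'_ at h4
          simp [pathPrefix, h4]
    have h2 : cylinderSet (u ++ [a]) =
        (fun ω : PathSpace m => (Preorder.frestrictLe n ω, ω (n + 1))) ⁻¹' ({s} ×ˢ {a}) := by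
      have h3 : ∀ ω : PathSpace m, ω ∈ cylinderSet (u ++ [a]) ↔
          ω ∈ cylinderSet u ∧ ω (n + 1) = a := by
        intro ω
        simp only [cylinderSet, Set.mem_ofPred_eq, List.length_append, List.length_singleton]
        rw [hlen, pathPrefix, List.ofFn_succ_last]
        constructor
        · intro h
          have h' := List.append_inj' h rfl
          exact ⟨h'.1, List.singleton_inj.1 h'.2⟩
        · rintro ⟨h, rfl⟩
          exact congrArg (fun l => l ++ [ω (n + 1)]) h
      ext ω
      rw [h3, h1]
      simp
    have h3 := Kernel.map_frestrictLe_trajMeasure_compProd_eq_map_trajMeasure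
      (X := fun _ => Fin (m + 1)) (μ₀ := T.stepMeasure []) (κ := T.stepKernel) (a := n)
    have h4 := congrArg (fun μ => μ ({s} ×ˢ {a})) h3
    rw [Measure.map_apply (by fun_prop) (measurableSet_singleton s |>.prod
      (measurableSet_singleton a)), Measure.compProd_apply_prod (measurableSet_singleton s)
      (measurableSet_singleton a), lintegral_singleton,
      Measure.map_apply (by fun_prop) (measurableSet_singleton s)] at h4
    rw [h1, h2]
    refine h4.symm.trans ?_
    rw [mul_comm]
    congr 1
    change T.stepMeasure (List.ofFn fun i : Fin (n + 1) =>
        s ⟨i, Finset.mem_Iic.2 (Nat.lt_succ_iff.1 i.2)⟩) {a} = _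
    rw [hs, stepMeasure_singleton]

/-! The operator-valued objects. -/

/-- `R₀` as an element of `S₁(H)`. -/
def initialTC (hT : IsTraceClass T.R0) : TraceClass H := TraceClass.mk T.R0 hT

/-- The dissipation process in `S₁(H)`; as for `dissipationAt`, the index is shifted by one, so
that `T.dissipationTC hT n ω` is `D_{n+1}(ω)`. -/
def dissipationTC (hT : IsTraceClass T.R0) (n : ℕ) (ω : PathSpace m) : TraceClass H :=
  TraceClass.mk (T.dissipationAt n ω)
    (IsTraceClass.of_le (T.dissipation_mem _ _).1 (T.dissipation_mem _ _).2 hT)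

/-- The tail residual `R_∞(ω)` as an element of `S₁(H)`. -/
def tailTC (ω : PathSpace m) : TraceClass H := TraceClass.ofOp (T.tailResidual ω)

/-- The total dissipation `Σ(ω) = ∑_{n=1}^{τ(ω)-1} D_n(ω)`, a sum in the trace norm. -/
def totalDissipation (hT : IsTraceClass T.R0) (ω : PathSpace m) : TraceClass H :=
  ∑' n : {n : ℕ // (n : ℕ∞) + 1 < terminationTime ω}, T.dissipationTC hT n ω

/-- The set function `M(E) = ∑_{n ≥ 1} ∫_E D_n dν_tr`, with Bochner integrals in `S₁(H)` and a sum
in the trace norm. -/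
def dissipationMeasure (hT : IsTraceClass T.R0) (E : Set (PathSpace m)) : TraceClass H :=
  ∑' n : ℕ, ∫ ω in E, T.dissipationTC hT n ω ∂T.traceMeasure

/-- Uniform trace leakage: for some `α ∈ (0, m]`, `s_w ≥ α tr R_w` at every node `w`. -/
def UniformTraceLeakage : Prop :=
  ∃ α : ℝ, 0 < α ∧ α ≤ m ∧
    ∀ w : List (Fin m), α * (opTrace (T.nodeResidual w)).re ≤ T.nodeEnergy w

end ContractionTree

end EnergyTree

end WR

end

noncomputable section

namespace WR

/-! ### Trace and trace norm on `S₁(H)` -/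

section Trace

variable {H : Type*} [NormedAddCommGroup H] [InnerProductSpace ℂ H] [CompleteSpace H]

/-! Along a path each residual is its successor plus a positive dissipated piece, so the partial
sums of the pieces telescope to `R₀ - R_n`. On the positive cone the trace norm is the trace, hence
additive, and the telescoping becomes the scalar identity `sum_range_norm_dissipationTC`: the norms
of the pieces sum to at most `‖R₀‖₁`. This holds on every path. By completeness of `S₁(H)` the
series converges absolutely, so `R_n → R₀ - Σ` in trace norm, and this limit must be the strong
limit `R_∞`.

The bound `‖R₀‖₁` is uniform in `ω`, so it dominates everything in sight. Dominated convergence for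
series (`hasSum_setIntegral_dissipationTC`) gives `M(E) = ∫_E Σ`; countable additivity and absolute
continuity are then those of an indefinite Bochner integral, and the total mass follows from `Σ = R₀
- R_∞` and continuity of the trace.

Under leakage, write `d_j` for the edge energies at a node and `s` for their sum. The letter `j` has
probability `d_j / s` and lowers the trace by `d_j`, so the expected drop is `∑ d_j² / s ≥ s / m ≥
(α / m) tr R` by Cauchy–Schwarz (`sum_wordProb_mul_residualTrace_append_le`). Thus the expected
trace decays geometrically and `R_∞ = 0` almost surely. -/

theorem norm_opTrace_le (A : TraceClass H) : ‖opTrace (TraceClass.toOp A)‖ ≤ ‖A‖ := by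
  have h1 : ∑' i, ‖⟪basis H i, TraceClass.toOp A (basis H i)⟫_ℂ‖ₑ ≤
      traceNormE (TraceClass.toOp A) := by
    -- The identity is the contraction here; `norm_id_le` also covers `H = 0`, where its norm is not
    -- `1`.
    have h := tsum_enorm_inner_le (TraceClass.toOp A) 1
      ContinuousLinearMap.norm_id_le
    simpa using h
  have h2 : ‖opTrace (TraceClass.toOp A)‖ₑ ≤ ENNReal.ofReal ‖A‖ := by
    rw [TraceClass.ofReal_norm_eq]
    exact (enorm_tsum_le_tsum_enorm (f := fun i =>
      ⟪basis H i, TraceClass.toOp A (basis H i)⟫_ℂ)).trans h1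
  rw [← ofReal_norm] at h2
  exact (ENNReal.ofReal_le_ofReal_iff (norm_nonneg _)).1 h2

/-- The trace as a bounded linear functional on `S₁(H)`. -/
def traceCLM (H : Type*) [NormedAddCommGroup H] [InnerProductSpace ℂ H] [CompleteSpace H] :
    TraceClass H →L[ℂ] ℂ :=
  LinearMap.mkContinuous
    { toFun := fun A => opTrace (TraceClass.toOp A)
      map_add' := fun A B => by
        have hA := hasSum_opTrace (basis H) _ (TraceClass.isTraceClass A)
        have hB := hasSum_opTrace (basis H) _ (TraceClass.isTraceClass B)
        have hAB := hasSum_opTrace (basis H) _ (TraceClass.isTraceClass (A + B))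
        refine hAB.unique ?_
        simpa [inner_add_right] using hA.add hB
      map_smul' := fun c A => by
        have hA := hasSum_opTrace (basis H) _ (TraceClass.isTraceClass A)
        have hc := hasSum_opTrace (basis H) _ (TraceClass.isTraceClass (c • A))
        refine hc.unique ?_
        simpa [inner_smul_right] using hA.mul_left c } 1
    fun A => by simpa using norm_opTrace_le A

@[simp] theorem traceCLM_apply (A : TraceClass H) :
    traceCLM H A = opTrace (TraceClass.toOp A) := rfl

/-- The inclusion `S₁(H) → B(H)` as a bounded linear map. -/
def toOpCLM (H : Type*) [NormedAddCommGroup H] [InnerProductSpace ℂ H] [CompleteSpace H] :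
    TraceClass H →L[ℂ] (H →L[ℂ] H) :=
  TraceClass.toOp.mkContinuous 1 fun A => by simpa using TraceClass.norm_toOp_le A

@[simp] theorem toOpCLM_apply (A : TraceClass H) : toOpCLM H A = TraceClass.toOp A := rfl

/-- Here `|A| = A`. Consequently the norm is additive on the positive cone, which turns operator
telescoping into an exact identity of norms. -/
theorem TraceClass.norm_eq_opTrace (A : TraceClass H) (hA : 0 ≤ toOp A) :
    ‖A‖ = (opTrace (toOp A)).re := by
  have h := (hasSum_opTrace (basis H) _ (isTraceClass A)).mapL Complex.reCLM
  have hpos : ∀ i, 0 ≤ (⟪basis H i, toOp A (basis H i)⟫_ℂ).re := fun i =>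
    ((ContinuousLinearMap.nonneg_iff_isPositive _).1 hA).re_inner_nonneg_right _
  rw [norm_def, traceNormE, CFC.abs_of_nonneg _ hA,
    ← ENNReal.ofReal_tsum_of_nonneg hpos h.summable,
    ENNReal.toReal_ofReal (tsum_nonneg hpos)]
  exact h.tsum_eq

theorem TraceClass.ofOp_of_isTraceClass {A : H →L[ℂ] H} (hA : IsTraceClass A) :
    ofOp A = mk A hA := dif_pos hA

end Trace

/-! ### Prefixes, stems and the termination time -/

section Words

variable {m : ℕ}

theorem pathPrefix_succ (ω : PathSpace m) (n : ℕ) :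
    pathPrefix ω (n + 1) = pathPrefix ω n ++ [ω n] := List.ofFn_succ_last

theorem stem_append_of_mem {u : List (Fin (m + 1))} (h : 0 ∈ u) (v : List (Fin (m + 1))) :
    stem (u ++ v) = stem u := by
  induction u with
  | nil => simp at h
  | cons a u ih =>
    induction a using Fin.cases with
    | zero => rfl
    | succ j =>
      have h' : 0 ∈ u := by simpa [(Fin.succ_ne_zero j).symm] using h
      simp [stem, ih h']

theorem stem_append_of_notMem {u : List (Fin (m + 1))} (h : 0 ∉ u) (v : List (Fin (m + 1))) :
    stem (u ++ v) = stem u ++ stem v := by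
  induction u with
  | nil => rfl
  | cons a u ih =>
    induction a using Fin.cases with
    | zero => simp at h
    | succ j =>
      have h' : 0 ∉ u := fun h' => h (List.mem_cons_of_mem _ h')
      simp [stem, ih h']

theorem lt_terminationTime_of_forall {ω : PathSpace m} {n : ℕ} (h : ∀ k ≤ n, ω k ≠ 0) :
    (n : ℕ∞) + 1 < terminationTime ω := by
  -- The letter `ω k` is read at time `k + 1`, so no termination occurs before time `n + 2`. The
  -- non-strict bound passes through the infimum, also when the set is empty and `τ = ∞`.
  have h1 : (n : ℕ∞) + 1 + 1 ≤ terminationTime ω := by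
    refine le_sInf ?_
    rintro t ⟨k, hk, rfl⟩
    have : n < k := by
      by_contra hkn
      exact h k (not_lt.1 hkn) hk
    exact_mod_cast Nat.succ_le_succ this
  refine lt_of_lt_of_le ?_ h1
  exact_mod_cast Nat.lt_succ_self (n + 1)

end Words

/-! ### Pathwise splitting and telescoping -/

namespace ContractionTree

variable {H : Type*} [NormedAddCommGroup H] [InnerProductSpace ℂ H] [CompleteSpace H] {m : ℕ}
  (T : ContractionTree m H)

/-- The letter `0` and all letters after it dissipate nothing, which matches the freezing of the
stem; hence one splitting rule serves the whole alphabet. -/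
theorem residual_append (u : List (Fin (m + 1))) (a : Fin (m + 1)) :
    T.residual (u ++ [a]) = T.residual u - T.dissipation u a := by
  unfold residual dissipation
  split_ifs with h
  · rw [stem_append_of_mem h, sub_zero]
  · rw [stem_append_of_notMem h]
    induction a using Fin.cases with
    | zero => simp [stem]
    | succ j => simp [stem, nodeDissipation_eq_sub]

theorem residualAt_zero (ω : PathSpace m) : T.residualAt 0 ω = T.R0 := rfl

theorem residualAt_succ (n : ℕ) (ω : PathSpace m) :
    T.residualAt (n + 1) ω = T.residualAt n ω - T.dissipationAt n ω := by
  rw [residualAt, pathPrefix_succ, residual_append]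
  rfl

theorem sum_range_dissipationAt (n : ℕ) (ω : PathSpace m) :
    ∑ k ∈ Finset.range n, T.dissipationAt k ω = T.R0 - T.residualAt n ω := by
  rw [← T.residualAt_zero ω, ← Finset.sum_range_sub' fun k => T.residualAt k ω]
  refine Finset.sum_congr rfl fun k _ => ?_
  rw [residualAt_succ, sub_sub_cancel]

theorem residualAt_nonneg (n : ℕ) (ω : PathSpace m) : 0 ≤ T.residualAt n ω :=
  T.nodeResidual_nonneg _

theorem residualAt_le (n : ℕ) (ω : PathSpace m) : T.residualAt n ω ≤ T.R0 :=
  T.nodeResidual_le _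

theorem dissipationAt_nonneg (n : ℕ) (ω : PathSpace m) : 0 ≤ T.dissipationAt n ω :=
  (T.dissipation_mem _ _).1

/-- Pieces vanish from termination on, so the sum up to `τ - 1` can be replaced by the sum over all
of `ℕ`. -/
theorem lt_terminationTime_of_dissipationAt_ne_zero {n : ℕ} {ω : PathSpace m}
    (h : T.dissipationAt n ω ≠ 0) : (n : ℕ∞) + 1 < terminationTime ω := by
  refine lt_terminationTime_of_forall fun k hk h0 => h ?_
  unfold dissipationAt dissipation
  -- An earlier `0` lies in the prefix; for `k = n` it is the letter being read.
  rcases hk.lt_or_eq with hlt | rfl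
  · rw [if_pos]
    exact List.mem_ofFn.2 ⟨⟨k, hlt⟩, h0⟩
  · rw [h0]
    simp

/-! ### Trace-norm convergence and the tail residual -/

variable (hT : IsTraceClass T.R0)

/-- The residual process in `S₁(H)`. -/
def residualTC (n : ℕ) (ω : PathSpace m) : TraceClass H :=
  TraceClass.mk (T.residualAt n ω)
    (IsTraceClass.of_le (T.residualAt_nonneg n ω) (T.residualAt_le n ω) hT)

@[simp] theorem toOp_residualTC (n : ℕ) (ω : PathSpace m) :
    TraceClass.toOp (T.residualTC hT n ω) = T.residualAt n ω := rfl

@[simp] theorem toOp_dissipationTC (n : ℕ) (ω : PathSpace m) :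
    TraceClass.toOp (T.dissipationTC hT n ω) = T.dissipationAt n ω := rfl

@[simp] theorem toOp_initialTC : TraceClass.toOp (T.initialTC hT) = T.R0 := rfl

theorem sum_range_dissipationTC (n : ℕ) (ω : PathSpace m) :
    ∑ k ∈ Finset.range n, T.dissipationTC hT k ω = T.initialTC hT - T.residualTC hT n ω := by
  apply TraceClass.toOp_injective
  simp [map_sum, sum_range_dissipationAt]

theorem norm_dissipationTC (n : ℕ) (ω : PathSpace m) :
    ‖T.dissipationTC hT n ω‖ = (traceCLM H (T.dissipationTC hT n ω)).re :=
  TraceClass.norm_eq_opTrace _ (T.dissipationAt_nonneg n ω)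

theorem norm_residualTC (n : ℕ) (ω : PathSpace m) :
    ‖T.residualTC hT n ω‖ = (traceCLM H (T.residualTC hT n ω)).re :=
  TraceClass.norm_eq_opTrace _ (T.residualAt_nonneg n ω)

theorem norm_initialTC : ‖T.initialTC hT‖ = (traceCLM H (T.initialTC hT)).re :=
  TraceClass.norm_eq_opTrace _ T.R0_nonneg

/-- All operators involved are positive, so norms are traces and linearity of the trace transfers
the telescoping sum. -/
theorem sum_range_norm_dissipationTC (n : ℕ) (ω : PathSpace m) :
    ∑ k ∈ Finset.range n, ‖T.dissipationTC hT k ω‖ =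
      ‖T.initialTC hT‖ - ‖T.residualTC hT n ω‖ := by
  simp_rw [norm_dissipationTC, norm_residualTC, norm_initialTC]
  rw [← Complex.re_sum, ← map_sum, sum_range_dissipationTC, map_sub, Complex.sub_re]

theorem sum_range_norm_dissipationTC_le (n : ℕ) (ω : PathSpace m) :
    ∑ k ∈ Finset.range n, ‖T.dissipationTC hT k ω‖ ≤ ‖T.initialTC hT‖ := by
  rw [sum_range_norm_dissipationTC]
  exact sub_le_self _ (norm_nonneg _)

theorem norm_residualTC_le (n : ℕ) (ω : PathSpace m) :
    ‖T.residualTC hT n ω‖ ≤ ‖T.initialTC hT‖ := by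
  have h := T.sum_range_norm_dissipationTC hT n ω
  have : 0 ≤ ∑ k ∈ Finset.range n, ‖T.dissipationTC hT k ω‖ :=
    Finset.sum_nonneg fun _ _ => norm_nonneg _
  linarith

theorem summable_norm_dissipationTC (ω : PathSpace m) :
    Summable fun n => ‖T.dissipationTC hT n ω‖ :=
  summable_of_sum_range_le (fun _ => norm_nonneg _)
    fun n => T.sum_range_norm_dissipationTC_le hT n ω

theorem tsum_norm_dissipationTC_le (ω : PathSpace m) :
    ∑' n, ‖T.dissipationTC hT n ω‖ ≤ ‖T.initialTC hT‖ :=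
  Real.tsum_le_of_sum_range_le (fun _ => norm_nonneg _)
    fun n => T.sum_range_norm_dissipationTC_le hT n ω

theorem hasSum_subtype_dissipationTC_iff (ω : PathSpace m) (A : TraceClass H) :
    HasSum (fun n : {n : ℕ // (n : ℕ∞) + 1 < terminationTime ω} => T.dissipationTC hT n ω) A ↔
      HasSum (fun n => T.dissipationTC hT n ω) A := by
  refine hasSum_subtype_iff_of_support_subset (f := fun n => T.dissipationTC hT n ω)
    (s := {n : ℕ | (n : ℕ∞) + 1 < terminationTime ω}) fun n hn => ?_
  refine T.lt_terminationTime_of_dissipationAt_ne_zero fun h0 => hn ?_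
  exact TraceClass.toOp_injective (by simpa using h0)

/-- Absolute convergence suffices because `S₁(H)` is complete. The proof passes through the subtype
since `totalDissipation` is a `tsum` over times before termination. -/
theorem hasSum_totalDissipation (ω : PathSpace m) :
    HasSum (fun n => T.dissipationTC hT n ω) (T.totalDissipation hT ω) := by
  rw [← hasSum_subtype_dissipationTC_iff]
  have h := (T.summable_norm_dissipationTC hT ω).of_norm.hasSum
  exact ((T.hasSum_subtype_dissipationTC_iff hT ω _).2 h).summable.hasSum

theorem totalDissipation_nonneg (ω : PathSpace m) :
    0 ≤ TraceClass.toOp (T.totalDissipation hT ω) :=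
  ((T.hasSum_totalDissipation hT ω).mapL (toOpCLM H)).nonneg fun n => T.dissipationAt_nonneg n ω

theorem tendsto_residualTC (ω : PathSpace m) :
    Tendsto (fun n => T.residualTC hT n ω) atTop
      (𝓝 (T.initialTC hT - T.totalDissipation hT ω)) := by
  refine (tendsto_const_nhds.sub (T.hasSum_totalDissipation hT ω).tendsto_sum_nat).congr
    fun n => ?_
  rw [sum_range_dissipationTC, sub_sub_cancel]

theorem tendsto_residualAt_apply (ω : PathSpace m) (x : H) :
    Tendsto (fun n => T.residualAt n ω x) atTop
      (𝓝 (TraceClass.toOp (T.initialTC hT - T.totalDissipation hT ω) x)) := by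
  have h := ((toOpCLM H).continuous.tendsto _).comp (T.tendsto_residualTC hT ω)
  exact ((ContinuousLinearMap.apply ℂ H x).continuous.tendsto _).comp h

include hT in
-- Trace-norm convergence supplies a strong limit, so `tailResidual` never takes its default value.
theorem tendsto_residualAt_tailResidual (ω : PathSpace m) (x : H) :
    Tendsto (fun n => T.residualAt n ω x) atTop (𝓝 (T.tailResidual ω x)) := by
  have h : ∃ A : H →L[ℂ] H, ∀ x, Tendsto (fun n => T.residualAt n ω x) atTop (𝓝 (A x)) :=
    ⟨_, T.tendsto_residualAt_apply hT ω⟩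
  rw [tailResidual, dif_pos h]
  exact h.choose_spec x

theorem tailResidual_eq (ω : PathSpace m) :
    T.tailResidual ω = TraceClass.toOp (T.initialTC hT - T.totalDissipation hT ω) :=
  ContinuousLinearMap.ext fun x => tendsto_nhds_unique
    (T.tendsto_residualAt_tailResidual hT ω x) (T.tendsto_residualAt_apply hT ω x)

include hT in
-- This excludes the default value `0` of `ofOp` in `tailTC`.
theorem isTraceClass_tailResidual (ω : PathSpace m) : IsTraceClass (T.tailResidual ω) := by
  rw [T.tailResidual_eq hT]
  exact TraceClass.isTraceClass _

theorem tailTC_eq (ω : PathSpace m) :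
    T.tailTC ω = T.initialTC hT - T.totalDissipation hT ω := by
  rw [tailTC, TraceClass.ofOp_of_isTraceClass (T.isTraceClass_tailResidual hT ω)]
  exact TraceClass.toOp_injective (T.tailResidual_eq hT ω)

include hT in
theorem toOp_tailTC (ω : PathSpace m) : TraceClass.toOp (T.tailTC ω) = T.tailResidual ω := by
  rw [T.tailTC_eq hT, T.tailResidual_eq hT]

include hT in
theorem tailResidual_nonneg (ω : PathSpace m) : 0 ≤ T.tailResidual ω := by
  rw [T.tailResidual_eq hT]
  -- The positive cone of `B(H)` is closed in operator norm.
  exact ge_of_tendsto' (((toOpCLM H).continuous.tendsto _).comp (T.tendsto_residualTC hT ω))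
    fun n => T.residualAt_nonneg n ω

/-! Measurability and integration. -/

/-- Such a function factors through a finite discrete space, so nothing is needed of the target; in
particular `S₁(H)` need not be separable. -/
theorem stronglyMeasurable_comp_pathPrefix {E : Type*} [TopologicalSpace E] (n : ℕ)
    (f : List (Fin (m + 1)) → E) :
    StronglyMeasurable fun ω : PathSpace m => f (pathPrefix ω n) := by
  have h : StronglyMeasurable fun x : Fin n → Fin (m + 1) => f (List.ofFn x) :=
    StronglyMeasurable.of_discrete
  exact h.comp_measurable (g := fun (ω : PathSpace m) (i : Fin n) => ω i) (by fun_prop)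

theorem stronglyMeasurable_residualTC (n : ℕ) : StronglyMeasurable (T.residualTC hT n) :=
  stronglyMeasurable_comp_pathPrefix n fun u =>
    TraceClass.mk (T.residual u) (IsTraceClass.of_le (T.nodeResidual_nonneg _)
      (T.nodeResidual_le _) hT)

theorem integrable_residualTC (n : ℕ) : Integrable (T.residualTC hT n) T.traceMeasure :=
  Integrable.of_bound (T.stronglyMeasurable_residualTC hT n).aestronglyMeasurable
    ‖T.initialTC hT‖ (ae_of_all _ (T.norm_residualTC_le hT n))

theorem dissipationTC_eq_sub (n : ℕ) (ω : PathSpace m) :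
    T.dissipationTC hT n ω = T.residualTC hT n ω - T.residualTC hT (n + 1) ω :=
  TraceClass.toOp_injective (by simp [residualAt_succ])

theorem integrable_dissipationTC (n : ℕ) : Integrable (T.dissipationTC hT n) T.traceMeasure :=
  ((T.integrable_residualTC hT n).sub (T.integrable_residualTC hT (n + 1))).congr
    (ae_of_all _ fun ω => (T.dissipationTC_eq_sub hT n ω).symm)

include hT in
theorem stronglyMeasurable_tailTC : StronglyMeasurable T.tailTC := by
  refine stronglyMeasurable_of_tendsto atTop (T.stronglyMeasurable_residualTC hT)
    (tendsto_pi_nhds.2 fun ω => ?_)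
  rw [T.tailTC_eq hT]
  exact T.tendsto_residualTC hT ω

include hT in
theorem norm_tailTC_le (ω : PathSpace m) : ‖T.tailTC ω‖ ≤ ‖T.initialTC hT‖ := by
  rw [T.tailTC_eq hT]
  exact le_of_tendsto' (T.tendsto_residualTC hT ω).norm fun n => T.norm_residualTC_le hT n ω

include hT in
theorem integrable_tailTC : Integrable T.tailTC T.traceMeasure :=
  Integrable.of_bound (T.stronglyMeasurable_tailTC hT).aestronglyMeasurable
    ‖T.initialTC hT‖ (ae_of_all _ (T.norm_tailTC_le hT))

theorem totalDissipation_eq (ω : PathSpace m) :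
    T.totalDissipation hT ω = T.initialTC hT - T.tailTC ω := by
  rw [T.tailTC_eq hT, sub_sub_cancel]

theorem integrable_totalDissipation : Integrable (T.totalDissipation hT) T.traceMeasure :=
  ((integrable_const (T.initialTC hT)).sub (T.integrable_tailTC hT)).congr
    (ae_of_all _ fun ω => (T.totalDissipation_eq hT ω).symm)

/-- The `n`-th term is dominated by its own norm, and these norms sum pointwise to at most `‖R₀‖₁`,
which is integrable for a probability measure. -/
theorem hasSum_setIntegral_dissipationTC (E : Set (PathSpace m)) :
    HasSum (fun n => ∫ ω in E, T.dissipationTC hT n ω ∂T.traceMeasure)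
      (∫ ω in E, T.totalDissipation hT ω ∂T.traceMeasure) := by
  have hmeas : ∀ n, AEStronglyMeasurable (T.dissipationTC hT n) (T.traceMeasure.restrict E) :=
    fun n => (T.integrable_dissipationTC hT n).integrableOn.aestronglyMeasurable
  have hsm : ∀ n, StronglyMeasurable fun ω => ‖T.dissipationTC hT n ω‖ := fun n => by
    simp_rw [T.dissipationTC_eq_sub hT]
    exact ((T.stronglyMeasurable_residualTC hT n).sub
      (T.stronglyMeasurable_residualTC hT (n + 1))).norm
  refine hasSum_integral_of_dominated_convergence (fun n ω => ‖T.dissipationTC hT n ω‖) hmeas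
    (fun n => ae_of_all _ fun ω => le_rfl)
    (ae_of_all _ (T.summable_norm_dissipationTC hT)) ?_
    (ae_of_all _ (T.hasSum_totalDissipation hT))
  refine Integrable.of_bound (C := ‖T.initialTC hT‖) ?_ (ae_of_all _ fun ω => ?_)
  -- The sum of the norms is measurable as the pointwise limit of its partial sums.
  · refine (stronglyMeasurable_of_tendsto atTop
      (f := fun N ω => ∑ n ∈ Finset.range N, ‖T.dissipationTC hT n ω‖) (fun N => ?_)
      (tendsto_pi_nhds.2 fun ω =>
        (T.summable_norm_dissipationTC hT ω).hasSum.tendsto_sum_nat)).aestronglyMeasurable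
    exact Finset.stronglyMeasurable_fun_sum _ fun n _ => hsm n
  · rw [Real.norm_of_nonneg (tsum_nonneg fun _ => norm_nonneg _)]
    exact T.tsum_norm_dissipationTC_le hT ω

theorem dissipationMeasure_eq (E : Set (PathSpace m)) :
    T.dissipationMeasure hT E = ∫ ω in E, T.totalDissipation hT ω ∂T.traceMeasure :=
  (T.hasSum_setIntegral_dissipationTC hT E).tsum_eq

theorem dissipationMeasure_nonneg (E : Set (PathSpace m)) :
    0 ≤ TraceClass.toOp (T.dissipationMeasure hT E) := by
  -- The order lives on `B(H)`, so the integral is moved there through the bounded inclusion.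
  rw [dissipationMeasure_eq, ← toOpCLM_apply, ← ContinuousLinearMap.integral_comp_comm _
    (T.integrable_totalDissipation hT).integrableOn]
  exact integral_nonneg fun ω => T.totalDissipation_nonneg hT ω

theorem dissipationMeasure_univ :
    T.dissipationMeasure hT Set.univ = T.initialTC hT - ∫ ω, T.tailTC ω ∂T.traceMeasure := by
  rw [dissipationMeasure_eq, setIntegral_univ]
  simp_rw [totalDissipation_eq]
  rw [integral_sub (integrable_const _) (T.integrable_tailTC hT)]
  simp

/-! Extinction of the trace under uniform leakage. -/

/-- The real trace of the residual of a word. -/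
def residualTrace (u : List (Fin (m + 1))) : ℝ := (opTrace (T.residual u)).re

theorem residualTrace_nonneg (u : List (Fin (m + 1))) : 0 ≤ T.residualTrace u :=
  opTrace_re_nonneg (T.nodeResidual_nonneg _)

theorem norm_residualTC_eq (n : ℕ) (ω : PathSpace m) :
    ‖T.residualTC hT n ω‖ = T.residualTrace (pathPrefix ω n) := T.norm_residualTC hT n ω

include hT in
theorem residualTrace_append (u : List (Fin (m + 1))) (a : Fin (m + 1)) :
    T.residualTrace (u ++ [a]) = T.residualTrace u - (opTrace (T.dissipation u a)).re := by
  have hR : IsTraceClass (T.residual u) :=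
    IsTraceClass.of_le (T.nodeResidual_nonneg _) (T.nodeResidual_le _) hT
  have hD : IsTraceClass (T.dissipation u a) :=
    IsTraceClass.of_le (T.dissipation_mem u a).1 (T.dissipation_mem u a).2 hT
  -- `opTrace` is a `tsum`, additive only on trace class operators, hence the passage through
  -- `traceCLM`.
  have h : opTrace (T.residual u - T.dissipation u a) =
      opTrace (T.residual u) - opTrace (T.dissipation u a) :=
    map_sub (traceCLM H) (TraceClass.mk _ hR) (TraceClass.mk _ hD)
  rw [residualTrace, residual_append, h, Complex.sub_re]
  rfl

/-- The probability of a cylinder set. -/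
def wordProb (u : List (Fin (m + 1))) : ℝ := T.traceMeasure.real (cylinderSet u)

theorem wordProb_nonneg (u : List (Fin (m + 1))) : 0 ≤ T.wordProb u := measureReal_nonneg

theorem wordProb_append (u : List (Fin (m + 1))) (a : Fin (m + 1)) :
    T.wordProb (u ++ [a]) = T.wordProb u * T.transProb u a := by
  rw [wordProb, measureReal_def, traceMeasure_cylinderSet_append, ENNReal.toReal_mul,
    ENNReal.toReal_ofReal (T.transProb_nonneg u a)]
  rfl

theorem transProb_zero_of_ne {u : List (Fin (m + 1))} (hu : 0 ∉ u)
    (hs : T.nodeEnergy (stem u) ≠ 0) : T.transProb u 0 = 0 := by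
  simp [transProb, hu, hs]

section Leakage

variable {α : ℝ} (hα : 0 < α)
  (hleak : ∀ w : List (Fin m), α * (opTrace (T.nodeResidual w)).re ≤ T.nodeEnergy w)

include hα hleak

/-- Leakage makes dead ends harmless: a node without edge energy has no trace left to freeze. -/
theorem residualTrace_eq_zero {u : List (Fin (m + 1))} (hs : T.nodeEnergy (stem u) = 0) :
    T.residualTrace u = 0 := by
  have h1 := hleak (stem u)
  rw [hs] at h1
  exact le_antisymm (nonpos_of_mul_nonpos_right h1 hα) (T.residualTrace_nonneg u)

include hT

/-- The first `0` has positive probability only at a node with `s = 0`, where leakage forces trace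
zero; the trace stays frozen afterwards. -/
theorem wordProb_mul_residualTrace_of_mem (u : List (Fin (m + 1))) (hu : 0 ∈ u) :
    T.wordProb u * T.residualTrace u = 0 := by
  induction u using List.reverseRecOn with
  | nil => simp at hu
  | append_singleton u a ih =>
    rw [wordProb_append]
    by_cases h0 : 0 ∈ u
    · have h1 : T.residualTrace (u ++ [a]) = T.residualTrace u := by
        rw [residualTrace, residual, stem_append_of_mem h0]
        rfl
      rw [h1, mul_right_comm, ih h0, zero_mul]
    · obtain rfl : a = 0 := by
        simpa [h0, eq_comm] using hu
      by_cases hs : T.nodeEnergy (stem u) = 0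
      · have h1 : T.residualTrace (u ++ [0]) = T.residualTrace u := by
          rw [T.residualTrace_append hT]
          simp [dissipation, opTrace]
        rw [h1, T.residualTrace_eq_zero hα hleak hs, mul_zero]
      · rw [T.transProb_zero_of_ne h0 hs, mul_zero, zero_mul]

/-- The one-step contraction: the mean drop of the trace is `∑ d_j² / s`, and Cauchy–Schwarz over
the `m` edges costs the factor `1 / m` in `α / m`. -/
theorem sum_wordProb_mul_residualTrace_append_le (hm : 1 ≤ m) (u : List (Fin (m + 1))) :
    ∑ a, T.wordProb (u ++ [a]) * T.residualTrace (u ++ [a]) ≤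
      (1 - α / m) * (T.wordProb u * T.residualTrace u) := by
  have hle : ∀ a, T.residualTrace (u ++ [a]) ≤ T.residualTrace u := fun a => by
    rw [T.residualTrace_append hT]
    exact sub_le_self _ (opTrace_re_nonneg (T.dissipation_mem u a).1)
  simp_rw [wordProb_append, mul_assoc, ← Finset.mul_sum]
  -- If mass times trace vanishes, monotonicity of the trace settles the bound. Otherwise `u`
  -- contains no `0` and `s > 0`, so the energy quotients are the actual probabilities.
  by_cases hz : T.wordProb u * T.residualTrace u = 0
  · rw [hz, mul_zero]
    rcases mul_eq_zero.1 hz with h | h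
    · rw [h, zero_mul]
    · refine mul_nonpos_of_nonneg_of_nonpos (T.wordProb_nonneg u)
        (Finset.sum_nonpos fun a _ => mul_nonpos_of_nonneg_of_nonpos (T.transProb_nonneg u a) ?_)
      exact (hle a).trans h.le
  have h0 : 0 ∉ u := fun h0 => hz (T.wordProb_mul_residualTrace_of_mem hT hα hleak u h0)
  have hs : T.nodeEnergy (stem u) ≠ 0 := fun hs => hz (by
    rw [T.residualTrace_eq_zero hα hleak hs, mul_zero])
  have hspos : 0 < T.nodeEnergy (stem u) := lt_of_le_of_ne (T.nodeEnergy_nonneg _) hs.symm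
  have hmpos : (0 : ℝ) < m := by exact_mod_cast hm
  rw [mul_left_comm]
  refine mul_le_mul_of_nonneg_left ?_ (T.wordProb_nonneg u)
  have hsum : ∑ a, T.transProb u a * T.residualTrace (u ++ [a]) =
      T.residualTrace u - (∑ j, T.edgeEnergy (stem u) j ^ 2) / T.nodeEnergy (stem u) := by
    simp_rw [T.residualTrace_append hT, mul_sub, Finset.sum_sub_distrib, ← Finset.sum_mul,
      sum_transProb, one_mul]
    rw [Fin.sum_univ_succ, T.transProb_zero_of_ne h0 hs, zero_mul, zero_add, Finset.sum_div]
    congr 1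
    refine Finset.sum_congr rfl fun j _ => ?_
    simp only [transProb, dissipation, h0, hs, or_self, if_false, Fin.cases_succ]
    rw [← edgeEnergy]
    ring
  have hcs : T.nodeEnergy (stem u) ^ 2 ≤ m * ∑ j, T.edgeEnergy (stem u) j ^ 2 := by
    simpa [nodeEnergy] using sq_sum_le_card_mul_sum_sq (s := Finset.univ) (f := T.edgeEnergy (stem u))
  have h1 : T.nodeEnergy (stem u) / m ≤
      (∑ j, T.edgeEnergy (stem u) j ^ 2) / T.nodeEnergy (stem u) := by
    rw [div_le_div_iff₀ hmpos hspos]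
    nlinarith
  have h2 : α / m * T.residualTrace u ≤ T.nodeEnergy (stem u) / m := by
    rw [div_mul_eq_mul_div]
    exact div_le_div_of_nonneg_right (hleak (stem u)) hmpos.le
  rw [hsum]
  linarith

end Leakage

theorem integral_comp_pathPrefix (n : ℕ) (f : List (Fin (m + 1)) → ℝ) :
    ∫ ω, f (pathPrefix ω n) ∂T.traceMeasure =
      ∑ x : Fin n → Fin (m + 1), T.wordProb (List.ofFn x) * f (List.ofFn x) := by
  have hmeas : Measurable fun (ω : PathSpace m) (i : Fin n) => ω i := by fun_prop
  have h := integral_map (μ := T.traceMeasure) hmeas.aemeasurable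
    (f := fun x : Fin n → Fin (m + 1) => f (List.ofFn x))
    StronglyMeasurable.of_discrete.aestronglyMeasurable
  refine h.symm.trans ?_
  have : IsFiniteMeasure (T.traceMeasure.map fun (ω : PathSpace m) (i : Fin n) => ω i) :=
    Measure.isFiniteMeasure_map _ _
  rw [integral_fintype .of_finite]
  refine Finset.sum_congr rfl fun x _ => ?_
  rw [smul_eq_mul, measureReal_def, Measure.map_apply hmeas (measurableSet_singleton x)]
  -- What remains is that the fibre over `x` is a cylinder. Its length is written `(List.ofFn
  -- x).length` rather than `n`, hence the comparison entry by entry.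
  congr 3
  ext ω
  simp only [cylinderSet, pathPrefix, Set.mem_preimage, Set.mem_singleton_iff,
    Set.mem_ofPred_eq]
  constructor
  · rintro rfl
    apply List.ext_getElem <;> simp
  · intro h
    apply List.ofFn_injective
    rw [← h]
    apply List.ext_getElem <;> simp

theorem integral_norm_residualTC_succ_le (hm : 1 ≤ m) {α : ℝ} (hα : 0 < α)
    (hleak : ∀ w : List (Fin m), α * (opTrace (T.nodeResidual w)).re ≤ T.nodeEnergy w) (n : ℕ) :
    ∫ ω, ‖T.residualTC hT (n + 1) ω‖ ∂T.traceMeasure ≤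
      (1 - α / m) * ∫ ω, ‖T.residualTC hT n ω‖ ∂T.traceMeasure := by
  simp_rw [norm_residualTC_eq, integral_comp_pathPrefix]
  -- Splitting off the last letter groups words of length `n + 1` by their prefix, so the one-step
  -- bound applies prefix by prefix.
  rw [← (Fin.snocEquiv fun _ : Fin (n + 1) => Fin (m + 1)).sum_comp, Fintype.sum_prod_type_right,
    Finset.mul_sum]
  refine Finset.sum_le_sum fun x _ => ?_
  have h : ∀ a, List.ofFn (Fin.snocEquiv (fun _ : Fin (n + 1) => Fin (m + 1)) (a, x)) =
      List.ofFn x ++ [a] := fun a => by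
    rw [List.ofFn_succ_last]
    simp [Fin.snocEquiv]
  simp_rw [h]
  exact T.sum_wordProb_mul_residualTrace_append_le hT hα hleak hm _

include hT in
theorem ae_tailTC_eq_zero (hm : 1 ≤ m) (hleak : T.UniformTraceLeakage) :
    ∀ᵐ ω ∂T.traceMeasure, T.tailTC ω = 0 := by
  obtain ⟨α, hα, hαm, hleak⟩ := hleak
  have hmpos : (0 : ℝ) < m := by exact_mod_cast hm
  -- The bound `α ≤ m` keeps the ratio nonnegative, so that the one-step estimate can be iterated.
  have hq0 : 0 ≤ 1 - α / m := sub_nonneg.2 ((div_le_one hmpos).2 hαm)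
  have hq1 : 1 - α / m < 1 := sub_lt_self _ (div_pos hα hmpos)
  have hgeom : ∀ n, ∫ ω, ‖T.residualTC hT n ω‖ ∂T.traceMeasure ≤
      (1 - α / m) ^ n * ∫ ω, ‖T.residualTC hT 0 ω‖ ∂T.traceMeasure := by
    intro n
    induction n with
    | zero => simp
    | succ n ih =>
      rw [pow_succ', mul_assoc]
      exact (T.integral_norm_residualTC_succ_le hT hm hα hleak n).trans
        (mul_le_mul_of_nonneg_left ih hq0)
  have hlim : Tendsto (fun n => ∫ ω, ‖T.residualTC hT n ω‖ ∂T.traceMeasure) atTop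
      (𝓝 (∫ ω, ‖T.tailTC ω‖ ∂T.traceMeasure)) := by
    refine tendsto_integral_of_dominated_convergence (fun _ => ‖T.initialTC hT‖)
      (fun n => (T.integrable_residualTC hT n).norm.aestronglyMeasurable) (integrable_const _)
      (fun n => ae_of_all _ fun ω => by simpa using T.norm_residualTC_le hT n ω)
      (ae_of_all _ fun ω => ?_)
    rw [T.tailTC_eq hT]
    exact (T.tendsto_residualTC hT ω).norm
  -- The mean trace norm of the tail is the limit of the mean residual norms, which the geometric
  -- bound sends to zero.
  have hzero : ∫ ω, ‖T.tailTC ω‖ ∂T.traceMeasure = 0 := by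
    refine tendsto_nhds_unique hlim (squeeze_zero (fun n => integral_nonneg fun _ => norm_nonneg _)
      hgeom ?_)
    simpa using (tendsto_pow_atTop_nhds_zero_of_lt_one hq0 hq1).mul_const
      (∫ ω, ‖T.residualTC hT 0 ω‖ ∂T.traceMeasure)
  rw [integral_eq_zero_iff_of_nonneg (fun _ => norm_nonneg _) (T.integrable_tailTC hT).norm]
    at hzero
  filter_upwards [hzero] with ω hω
  exact norm_eq_zero.1 hω

end ContractionTree

end WR

end

theorem theorem6p2 {H : Type*} [NormedAddCommGroup H] [InnerProductSpace ℂ H] [CompleteSpace H]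
    {m : ℕ} (hm : 1 ≤ m) (T : WR.ContractionTree m H) (hT : WR.IsTraceClass T.R0) :
    -- the tail residual is well defined, with values in the positive cone of `S₁(H)`
    (∀ ω, (∀ x, Tendsto (fun n => T.residualAt n ω x) atTop (𝓝 (T.tailResidual ω x))) ∧
      0 ≤ T.tailResidual ω ∧ WR.IsTraceClass (T.tailResidual ω)) ∧
    -- convergence of the total dissipation in trace norm
    (∀ᵐ ω ∂T.traceMeasure,
      HasSum (fun n : {n : ℕ // (n : ℕ∞) + 1 < WR.terminationTime ω} => T.dissipationTC hT n ω)
        (T.totalDissipation hT ω) ∧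
      0 ≤ WR.TraceClass.toOp (T.totalDissipation hT ω) ∧
      T.totalDissipation hT ω = T.initialTC hT - T.tailTC ω) ∧
    -- the set function `M` is well defined, positive, countably additive, absolutely continuous,
    -- and has the density `Σ`
    ((∀ n, Integrable (T.dissipationTC hT n) T.traceMeasure) ∧
      (∀ E, MeasurableSet E →
        HasSum (fun n => ∫ ω in E, T.dissipationTC hT n ω ∂T.traceMeasure)
          (T.dissipationMeasure hT E) ∧
        0 ≤ WR.TraceClass.toOp (T.dissipationMeasure hT E)) ∧
      (∃ V : VectorMeasure (WR.PathSpace m) (WR.TraceClass H),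
        ∀ E, MeasurableSet E → V E = T.dissipationMeasure hT E) ∧
      (∀ E, MeasurableSet E → T.traceMeasure E = 0 → T.dissipationMeasure hT E = 0) ∧
      Integrable (T.totalDissipation hT) T.traceMeasure ∧
      (∀ E, MeasurableSet E →
        T.dissipationMeasure hT E = ∫ ω in E, T.totalDissipation hT ω ∂T.traceMeasure)) ∧
    -- the total mass
    (Integrable T.tailTC T.traceMeasure ∧
      T.dissipationMeasure hT Set.univ = T.initialTC hT - ∫ ω, T.tailTC ω ∂T.traceMeasure ∧
      Integrable (fun ω => WR.opTrace (T.tailResidual ω)) T.traceMeasure ∧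
      WR.opTrace (WR.TraceClass.toOp (T.dissipationMeasure hT Set.univ)) =
        WR.opTrace T.R0 - ∫ ω, WR.opTrace (T.tailResidual ω) ∂T.traceMeasure) ∧
    -- the case of trace extinction
    (T.UniformTraceLeakage →
      (∀ᵐ ω ∂T.traceMeasure, T.totalDissipation hT ω = T.initialTC hT) ∧
      (∀ E, MeasurableSet E →
        T.dissipationMeasure hT E = T.traceMeasure.real E • T.initialTC hT)) := by
  -- The assertions about `Σ` hold on every path, so no null set is discarded there. The vector
  -- measure is the one with density `Σ`, which brings countable additivity with it.
  refine ⟨fun ω => ⟨T.tendsto_residualAt_tailResidual hT ω, T.tailResidual_nonneg hT ω,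
    T.isTraceClass_tailResidual hT ω⟩, ae_of_all _ fun ω =>
    ⟨(T.hasSum_subtype_dissipationTC_iff hT ω _).2 (T.hasSum_totalDissipation hT ω),
      T.totalDissipation_nonneg hT ω, T.totalDissipation_eq hT ω⟩,
    ⟨T.integrable_dissipationTC hT, fun E _ => ⟨?_, T.dissipationMeasure_nonneg hT E⟩,
      ⟨T.traceMeasure.withDensityᵥ (T.totalDissipation hT), fun E hE => ?_⟩, fun E _ hE => ?_,
      T.integrable_totalDissipation hT, fun E _ => T.dissipationMeasure_eq hT E⟩,
    ⟨T.integrable_tailTC hT, T.dissipationMeasure_univ hT, ?_, ?_⟩, fun hleak => ?_⟩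
  · rw [T.dissipationMeasure_eq hT]
    exact T.hasSum_setIntegral_dissipationTC hT E
  · rw [withDensityᵥ_apply (T.integrable_totalDissipation hT) hE, T.dissipationMeasure_eq hT]
  · rw [T.dissipationMeasure_eq hT, setIntegral_measure_zero _ hE]
  · simp_rw [← T.toOp_tailTC hT, ← WR.traceCLM_apply]
    exact (WR.traceCLM H).integrable_comp (T.integrable_tailTC hT)
  · simp_rw [← T.toOp_tailTC hT, ← WR.traceCLM_apply]
    -- The trace is a bounded functional on `S₁(H)` and commutes with the Bochner integral.
    rw [ContinuousLinearMap.integral_comp_comm _ (T.integrable_tailTC hT),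
      T.dissipationMeasure_univ hT, map_sub]
    rfl
  · have h : ∀ᵐ ω ∂T.traceMeasure, T.totalDissipation hT ω = T.initialTC hT := by
      filter_upwards [T.ae_tailTC_eq_zero hT hm hleak] with ω hω
      rw [T.totalDissipation_eq hT, hω, sub_zero]
    refine ⟨h, fun E _ => ?_⟩
    rw [T.dissipationMeasure_eq hT, integral_congr_ae (ae_restrict_of_ae h), setIntegral_const]
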